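/- Let $G$ be a finite weighted directed graph on a vertex set $V$ with weights $w_{ij}\ge 0$ (an edge from $i$ to $j$ is present iff $w_{ij}>0$), strongly connected by directed walks of positive length. Let $d_i=\sum_j w_{ij}$, let $P_{ij}=w_{ij}/d_i$ be the transition matrix of the random walk on $G$, and let $\pi$ be its stationary distribution. Let $N\ge 1$, $1\le T<L$, let $f$ be a probability distribution on $V$, and let $\mathcal D$ be the corpus (a multiset of vertex pairs) generated from $N$ independent random walks $v_0,\dots,v_{L-1}$ on $G$ with $v_0\sim f$, which receives, for every walk and all $0\le j\le L-T-1$, $1\le r\le T$, the two pairs $(v_j,v_{j+r})$ and $(v_{j+r},v_j)$. For $v,c\in V$ let $m(v,c)$ be the multiplicity of $(v,c)$ in $\mathcal D$ and $$\omega(v,c)=\frac1{2T}\sum_{r=1}^T\bigl(\pi_v(P^r)_{vc}+\pi_c(P^r)_{cv}\bigr).$$ Then, for each of the following choices of $U$, $$\left|\mathbb E\left[\frac{m(v,c)}{|\mathcal D|}\right]-\omega(v,c)\right|\le U,\qquad\text{and}\qquad \mathbb P\left(\left|\frac{m(v,c)}{|\mathcal D|}-\omega(v,c)\right|>\varepsilon\right)<2\exp\bigl(-2N(\varepsilon-U)^2\bigr)\quad\text{whenever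 }\varepsilon>U>0.$$ 1. If $G$ is undirected ($w_{ij}=w_{ji}$), let $\lambda_1\le\dots\le\lambda_{|V|}$ be the eigenvalues of $I-D^{1/2}PD^{-1/2}$, where $D=\mathrm{diag}(d_i)$, and take $$U=\frac1{L-T}\,\frac{1-\phi_\star^{L-T}}{1-\phi_\star}\,\mathbb E_{s\sim f}\bigl[d_s^{-1/2}\bigr]\cdot\frac1{2T}\sum_{r=1}^T\bigl(\sqrt{d_v}(P^r)_{vc}+\sqrt{d_c}(P^r)_{cv}\bigr),$$ where $\phi_\star=\max\{|1-\lambda_2|,|1-\lambda_{|V|}|\}$ if $G$ is not bipartite and $|V|\ge2$, and $\phi_\star=\max\{|1-\lambda_2|,|1-\lambda_{|V|-1}|\}$ if $G$ is bipartite, $|V|\ge3$ and $L-T$ is even. In both cases this expression is $O(1/L)$ as $L\to\infty$ with $T$ fixed. 2. If $G$ is aperiodic, there are constants $C>0$ and $\alpha\in(0,1)$ with $\max_s\|P^t(s,\cdot)-\pi\|_{\mathrm{TV}}\le C\alpha^t$ for all $t\ge0$; for any such constants take $$U=\frac C{L-T}\,\frac{1-\alpha^{L-T}}{1-\alpha}\cdot\frac1{2T}\sum_{r=1}^T\bigl((P^r)_{vc}+(P^r)_{cv}\bigr).$$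 3. If $G$ has an arbitrary period, take $U=g/(L-T)$, where $g>0$ is a suitable constant that depends only on the graph (and not on $N,L,T,f,v,c,\varepsilon$). -/

import Mathlib

open MeasureTheory ProbabilityTheory Asymptotics

universe uΩ uV

namespace WalkCorpus

noncomputable section

variable {V : Type uV} [Fintype V] [DecidableEq V]

/-! ### Weighted graphs and their random walks

A finite weighted directed graph on `V` is given by its weight matrix `w`. It is strongly connected
with nonnegative weights exactly when `w.IsIrreducible`, and it is undirected when `w.IsSymm`. -/

/-- The (weighted) out-degree `d i = ∑ j, w i j`. -/
def outDegree (w : Matrix V V ℝ) (i : V) : ℝ := ∑ j, w i j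

/-- The transition matrix `P i j = w i j / d i` of the random walk on the graph. -/
def transition (w : Matrix V V ℝ) : Matrix V V ℝ :=
  Matrix.of fun i j => w i j / outDegree w i

/-- `p` is a stationary probability distribution of the transition matrix `P`. -/
def IsStationary (P : Matrix V V ℝ) (p : V → ℝ) : Prop :=
  p ∈ stdSimplex ℝ V ∧ Matrix.vecMul p P = p

/-- The graph is bipartite: every edge joins vertices of different colours. -/
def IsBipartite (w : Matrix V V ℝ) : Prop :=
  ∃ colour : V → Bool, ∀ i j, 0 < w i j → colour i ≠ colour j

/-- The graph is aperiodic: for every vertex, the greatest common divisor of the lengths of the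
closed walks of positive length through it is `1`. -/
def IsAperiodic (w : Matrix V V ℝ) : Prop :=
  ∀ (i : V) (d : ℕ), (∀ n : ℕ, 0 < n → 0 < (transition w ^ n) i i → d ∣ n) → d = 1

/-- Total variation distance of two distributions on the finite set `V`. -/
def tvDist (p q : V → ℝ) : ℝ := (1 / 2) * ∑ x, |p x - q x|

/-- `C > 0` and `α ∈ (0, 1)` are constants of geometric convergence to the stationary distribution:
`‖P ^ t (s, ·) - π‖_TV ≤ C α ^ t` for all starting vertices `s` and all times `t`. -/
def IsMixingConstants (w : Matrix V V ℝ) (p : V → ℝ) (C α : ℝ) : Prop :=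
  0 < C ∧ 0 < α ∧ α < 1 ∧
    ∀ (t : ℕ) (s : V), tvDist ((transition w ^ t) s) p ≤ C * α ^ t

/-! ### The symmetric normalised Laplacian -/

/-- `L^norm = I - D^{1/2} P D^{-1/2}`. -/
def normLaplacian (w : Matrix V V ℝ) : Matrix V V ℝ :=
  1 - Matrix.diagonal (fun i => √(outDegree w i)) * transition w *
    Matrix.diagonal (fun i => (√(outDegree w i))⁻¹)

theorem normLaplacian_isHermitian {w : Matrix V V ℝ} (hw : w.IsSymm) :
    (normLaplacian w).IsHermitian := by
  ext i j
  have h : w j i = w i j := hw.apply i j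
  have key : ∀ x y a : ℝ, √x * (a / x) * (√y)⁻¹ = a * ((√x)⁻¹ * (√y)⁻¹) := by
    intro x y a
    rw [← Real.sqrt_div_self (x := x)]
    ring
  simp only [normLaplacian, transition, Matrix.conjTranspose_apply, Matrix.sub_apply,
    Matrix.mul_diagonal, Matrix.diagonal_mul, Matrix.of_apply, star_trivial, key, h,
    Matrix.one_apply, eq_comm (a := j)]
  ring

/-- The `k`-th eigenvalue `λ_k`, `1 ≤ k ≤ |V|`, of the normalised Laplacian of an undirected graph,
in increasing order `λ_1 ≤ λ_2 ≤ ⋯ ≤ λ_{|V|}`. (Mathlib's `eigenvalues₀` is decreasing and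
indexed from `0`; the value `0` for `k` out of range is never used.) -/
def lapEigenvalue {w : Matrix V V ℝ} (hw : w.IsSymm) (k : ℕ) : ℝ :=
  if h : 1 ≤ k ∧ k ≤ Fintype.card V then
    (normLaplacian_isHermitian hw).eigenvalues₀ ⟨Fintype.card V - k, by omega⟩
  else 0

/-- `μ_⋆ = sup {|1 - λ_2|, |1 - λ_{|V|}|}`, used for non-bipartite graphs. -/
def muStar {w : Matrix V V ℝ} (hw : w.IsSymm) : ℝ :=
  max |1 - lapEigenvalue hw 2| |1 - lapEigenvalue hw (Fintype.card V)|

/-- `ν_⋆ = sup {|1 - λ_2|, |1 - λ_{|V| - 1}|}`, used for bipartite graphs. -/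
def nuStar {w : Matrix V V ℝ} (hw : w.IsSymm) : ℝ :=
  max |1 - lapEigenvalue hw 2| |1 - lapEigenvalue hw (Fintype.card V - 1)|

/-! ### The limit and the deterministic bounds -/

/-- `(1 / 2T) ∑_{r=1}^T (a_v (P^r)_{vc} + a_c (P^r)_{cv})`. -/
def windowAverage (w : Matrix V V ℝ) (T : ℕ) (a : V → ℝ) (v c : V) : ℝ :=
  1 / (2 * (T : ℝ)) * ∑ r ∈ Finset.Icc 1 T,
    (a v * (transition w ^ r) v c + a c * (transition w ^ r) c v)

/-- `ω(v, c) = (1 / 2T) ∑_{r=1}^T (π_v (P^r)_{vc} + π_c (P^r)_{cv})`. -/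
def omegaLimit (w : Matrix V V ℝ) (p : V → ℝ) (T : ℕ) (v c : V) : ℝ :=
  windowAverage w T p v c

/-- The bound for undirected graphs, with `φ` the spectral quantity `μ_⋆` or `ν_⋆` and `f` the
distribution of the starting vertex:
`1/(L-T) · (1-φ^(L-T))/(1-φ) · E_{s∼f}[d_s^{-1/2}] · (1/2T) ∑_r (√d_v (P^r)_{vc} + √d_c (P^r)_{cv})`.
-/
def undirectedBound (w : Matrix V V ℝ) (f : V → ℝ) (φ : ℝ) (T : ℕ) (v c : V) (L : ℕ) : ℝ :=
  1 / ((L : ℝ) - T) * ((1 - φ ^ (L - T)) / (1 - φ)) * (∑ s, f s * (√(outDegree w s))⁻¹) *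
    windowAverage w T (fun i => √(outDegree w i)) v c

/-- The bound for aperiodic directed graphs:
`C/(L-T) · (1-α^(L-T))/(1-α) · (1/2T) ∑_r ((P^r)_{vc} + (P^r)_{cv})`. -/
def aperiodicBound (w : Matrix V V ℝ) (C α : ℝ) (T : ℕ) (v c : V) (L : ℕ) : ℝ :=
  C / ((L : ℝ) - T) * ((1 - α ^ (L - T)) / (1 - α)) * windowAverage w T (fun _ => 1) v c

/-! ### Random walks and the corpus -/

/-- `Y 0, …, Y (L - 1)` is a random walk of length `L` with starting distribution `f` and transition
matrix `P`: the law of the path is that of the Markov chain. -/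
structure IsRandomWalk {Ω : Type uΩ} [MeasurableSpace Ω] [MeasurableSpace V] (μ : Measure Ω)
    (P : Matrix V V ℝ) (f : V → ℝ) (L : ℕ) (Y : ℕ → Ω → V) : Prop where
  measurable : ∀ i < L, Measurable (Y i)
  law : ∀ x : ℕ → V, μ.real {ω | ∀ i < L, Y i ω = x i} =
    f (x 0) * ∏ i ∈ Finset.range (L - 1), P (x i) (x (i + 1))

/-- `X n`, `n < N`, are independent random walks of length `L` on the graph, with starting vertices
drawn from `f`. -/
structure IsWalkSample {Ω : Type uΩ} [MeasurableSpace Ω] [MeasurableSpace V] (μ : Measure Ω)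
    (w : Matrix V V ℝ) (f : V → ℝ) (L N : ℕ) (X : Fin N → ℕ → Ω → V) : Prop where
  walk : ∀ n, IsRandomWalk μ (transition w) f L (X n)
  indep : iIndepFun (fun n ω (i : Fin L) => X n i ω) μ

/-- The corpus with window size `T` generated from the walks `x n 0, …, x n (L - 1)`, `n < N`: the
multiset that receives, for every walk, every `0 ≤ j ≤ L - T - 1` and every `1 ≤ r ≤ T`, the
two pairs `(v_j, v_{j+r})` and `(v_{j+r}, v_j)`. -/
def corpus (L T N : ℕ) (x : Fin N → ℕ → V) : Multiset (V × V) :=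
  ∑ n, ∑ j ∈ Finset.range (L - T), ∑ r ∈ Finset.Icc 1 T,
    {(x n j, x n (j + r)), (x n (j + r), x n j)}

/-- The relative frequency `m(v, c) / |𝒟|` of the pair `(v, c)` in the corpus `𝒟`. -/
def pairFreq (L T N : ℕ) (x : Fin N → ℕ → V) (v c : V) : ℝ :=
  ((corpus L T N x).count (v, c) : ℝ) / ((corpus L T N x).card : ℝ)

/-- `U` bounds the bias `|E[m(v, c)/|𝒟|] - ω(v, c)|`, and
`ℙ(|m(v, c)/|𝒟| - ω(v, c)| > ε) < 2 exp(-2N(ε - U)²)` for `ε > U > 0`, for every corpus generated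
from any number `N ≥ 1` of independent random walks of length `L` started from `f`. -/
def ConcentratesWith [MeasurableSpace V] (w : Matrix V V ℝ) (p f : V → ℝ) (L T : ℕ) (v c : V)
    (U : ℝ) : Prop :=
  ∀ (Ω : Type uΩ) [MeasurableSpace Ω] (μ : Measure Ω) [IsProbabilityMeasure μ]
    (N : ℕ) (X : Fin N → ℕ → Ω → V), 1 ≤ N → IsWalkSample μ w f L N X →
      |(∫ ω, pairFreq L T N (fun n i => X n i ω) v c ∂μ) - omegaLimit w p T v c| ≤ U ∧
      ∀ ε : ℝ, 0 < U → U < ε →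
        μ.real {ω | ε < |pairFreq L T N (fun n i => X n i ω) v c - omegaLimit w p T v c|} <
          2 * Real.exp (-2 * (N : ℝ) * (ε - U) ^ 2)

end

end WalkCorpus

/-!
The expected pair frequency is the same window average as `omegaLimit`, with the stationary
distribution `p` replaced by the mean of the laws `f P ^ j`, `j < L - T`, of the walk: this is the
Markov property, derived from the law of the path (`IsRandomWalk.measureReal_and`,
`integral_walkFreq`). The frequency in the whole corpus is the mean of `N` independent variables
with values in `[0, 1]`, so that Hoeffding's inequality around the expectation gives the tail bound
from the bound on the bias (`concentratesWith_of_bias_le`). The inequality is strict because the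
Chernoff bound is strict for the event of a strict excess (`measureReal_lt_lt_exp`).

What remains is to bound the accumulated deviation `∑_{j < n} ((f P ^ j) v - p v)`, with `n = L - T`
(`concentratesWith_of_occupation_le`).

* On an undirected graph `P` is conjugate to a symmetric matrix. In the spectral expansion of
  `P ^ j` the eigenvalue `1` contributes `p`, and every other eigenvalue `θ` contributes, over time,
  a geometric sum `∑_{j < n} θ ^ j` (`abs_sum_transition_pow_sub_le`). The maximum principle for
  irreducible chains (`eq_of_le_mulVec`) shows that `1` is simple, that `-1` is an eigenvalue exactly
  for bipartite graphs, and that it is simple then; hence `muStar < 1` and `nuStar < 1`. For even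
  `n` the geometric sum of `-1` vanishes.
* On an aperiodic graph the mixing bound is summed over time. Mixing constants exist because some
  power of `P` is positive (the return times to a vertex form a numerical semigroup) and a
  positive stochastic matrix contracts the `ℓ¹` norm on vectors of total mass `0`.
* In general the deviation telescopes along a solution of the Poisson equation
  (`exists_occupation_le`), which exists without any assumption on the period.
-/

namespace WalkCorpus

/-! ### Irreducible stochastic matrices -/

section Stochastic

open Matrix

variable {V : Type uV} [Fintype V] [DecidableEq V]

theorem outDegree_pos {w : Matrix V V ℝ} (hw : w.IsIrreducible) (i : V) : 0 < outDegree w i := by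
  obtain ⟨k, hk, hpos⟩ := (isIrreducible_iff_exists_pow_pos hw.nonneg).1 hw i i
  refine (Finset.sum_nonneg fun j _ => hw.nonneg i j).lt_of_ne fun h => ?_
  have h0 : ∀ j, w i j = 0 := fun j =>
    (Finset.sum_eq_zero_iff_of_nonneg fun j _ => hw.nonneg i j).1 h.symm j (Finset.mem_univ j)
  obtain ⟨m, rfl⟩ := Nat.exists_eq_succ_of_ne_zero hk.ne'
  rw [Nat.succ_eq_add_one, pow_succ', mul_apply] at hpos
  simp [h0] at hpos

theorem transition_apply {V : Type uV} [Fintype V] (w : Matrix V V ℝ) (i j : V) :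
    transition w i j = w i j / outDegree w i := rfl

theorem transition_pos_iff {w : Matrix V V ℝ} (hw : w.IsIrreducible) {i j : V} :
    0 < transition w i j ↔ 0 < w i j := by
  rw [transition_apply, div_pos_iff_of_pos_right (outDegree_pos hw i)]

theorem transition_mem_rowStochastic {w : Matrix V V ℝ} (hw : w.IsIrreducible) :
    transition w ∈ rowStochastic ℝ V := by
  rw [mem_rowStochastic_iff_sum]
  refine ⟨fun i j => div_nonneg (hw.nonneg i j) (outDegree_pos hw i).le, fun i => ?_⟩
  simp only [transition_apply, ← Finset.sum_div]
  exact div_self (outDegree_pos hw i).ne'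

theorem transition_isIrreducible {w : Matrix V V ℝ} (hw : w.IsIrreducible) :
    (transition w).IsIrreducible := by
  have h : (transition w).toQuiver = w.toQuiver := by
    unfold Matrix.toQuiver
    simp only [transition_pos_iff hw]
  refine ⟨(transition_mem_rowStochastic hw).1, ?_⟩
  rw [h]
  exact hw.connected

theorem exists_pow_pos {P : Matrix V V ℝ} (hP : P.IsIrreducible) (i j : V) :
    ∃ k > 0, 0 < (P ^ k) i j :=
  (isIrreducible_iff_exists_pow_pos hP.nonneg).1 hP i j

theorem mulVec_mono {P : Matrix V V ℝ} (hP : P ∈ rowStochastic ℝ V) {x y : V → ℝ} (h : x ≤ y) :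
    P *ᵥ x ≤ P *ᵥ y := fun i =>
  Finset.sum_le_sum fun j _ => mul_le_mul_of_nonneg_left (h j) (hP.1 i j)

theorem le_pow_mulVec {P : Matrix V V ℝ} (hP : P ∈ rowStochastic ℝ V) {y : V → ℝ}
    (h : y ≤ P *ᵥ y) (k : ℕ) : y ≤ (P ^ k) *ᵥ y := by
  induction k with
  | zero => simp
  | succ k ih =>
    rw [pow_succ', ← mulVec_mulVec]
    exact h.trans (mulVec_mono hP ih)

/-- The maximum principle: a subharmonic function of an irreducible chain is constant. -/
theorem eq_of_le_mulVec {P : Matrix V V ℝ} (hP : P ∈ rowStochastic ℝ V) (hirr : P.IsIrreducible)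
    {y : V → ℝ} (h : y ≤ P *ᵥ y) (i j : V) : y i = y j := by
  obtain ⟨m, -, hm⟩ := Finset.exists_max_image Finset.univ y ⟨i, Finset.mem_univ i⟩
  suffices H : ∀ l, y m = y l by rw [← H i, ← H j]
  intro l
  obtain ⟨k, -, hk⟩ := exists_pow_pos hirr m l
  have hPk := pow_mem hP k
  have hnn : ∀ a ∈ Finset.univ, 0 ≤ (P ^ k) m a * (y m - y a) := fun a ha =>
    mul_nonneg (hPk.1 m a) (sub_nonneg.2 (hm a ha))
  have hle : ∑ a, (P ^ k) m a * (y m - y a) ≤ 0 := by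
    simp only [mul_sub, Finset.sum_sub_distrib, ← Finset.sum_mul,
      sum_row_of_mem_rowStochastic hPk m, one_mul]
    exact sub_nonpos.2 (le_pow_mulVec hP h k m)
  have hz := (Finset.sum_eq_zero_iff_of_nonneg hnn).1 (le_antisymm hle (Finset.sum_nonneg hnn)) l
    (Finset.mem_univ l)
  exact sub_eq_zero.1 ((mul_eq_zero.1 hz).resolve_left hk.ne')

theorem abs_mulVec_le {P : Matrix V V ℝ} (hP : P ∈ rowStochastic ℝ V) (x : V → ℝ) (i : V) :
    |(P *ᵥ x) i| ≤ (P *ᵥ fun j => |x j|) i := by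
  refine (Finset.abs_sum_le_sum_abs _ _).trans_eq (Finset.sum_congr rfl fun j _ => ?_)
  rw [abs_mul, abs_of_nonneg (hP.1 i j)]

theorem abs_eigenvalue_le_one {P : Matrix V V ℝ} (hP : P ∈ rowStochastic ℝ V) {x : V → ℝ} {θ : ℝ}
    (hx : x ≠ 0) (h : P *ᵥ x = θ • x) : |θ| ≤ 1 := by
  obtain ⟨i, hi⟩ := Function.ne_iff.1 hx
  obtain ⟨m, -, hm⟩ := Finset.exists_max_image Finset.univ (fun a => |x a|) ⟨i, Finset.mem_univ i⟩
  have hpos : 0 < |x m| := (abs_pos.2 hi).trans_le (hm i (Finset.mem_univ i))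
  refine le_of_mul_le_mul_right ?_ hpos
  calc |θ| * |x m| = |(P *ᵥ x) m| := by rw [h, Pi.smul_apply, smul_eq_mul, abs_mul]
    _ ≤ (P *ᵥ fun j => |x j|) m := abs_mulVec_le hP x m
    _ ≤ ∑ j, P m j * |x m| := Finset.sum_le_sum fun j hj =>
        mul_le_mul_of_nonneg_left (hm j hj) (hP.1 m j)
    _ = 1 * |x m| := by rw [← Finset.sum_mul, sum_row_of_mem_rowStochastic hP]

/-- An eigenvector for the eigenvalue `-1` of an irreducible chain has constant absolute value and
changes sign along every edge. -/
theorem eq_neg_of_mulVec_eq_neg {P : Matrix V V ℝ} (hP : P ∈ rowStochastic ℝ V)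
    (hirr : P.IsIrreducible) {x : V → ℝ} (hx : x ≠ 0) (h : P *ᵥ x = -x) :
    (∀ i, x i ≠ 0) ∧ ∀ i j, 0 < P i j → x j = -x i := by
  have habs : ∀ i j, |x i| = |x j| := eq_of_le_mulVec (y := fun j => |x j|) hP hirr fun i => by
    have := abs_mulVec_le hP x i
    rwa [h, Pi.neg_apply, abs_neg] at this
  obtain ⟨a, ha⟩ := Function.ne_iff.1 hx
  have hne : ∀ i, x i ≠ 0 := fun i => by
    rw [← abs_pos, habs i a]
    exact abs_pos.2 ha
  refine ⟨hne, fun i j hij => ?_⟩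
  have hnn : ∀ l ∈ Finset.univ, 0 ≤ P i l * (x i * (x l + x i)) := fun l _ => by
    refine mul_nonneg (hP.1 i l) ?_
    have h1 : |x i * x l| = x i * x i := by rw [abs_mul, habs l i, abs_mul_abs_self]
    have h2 := neg_abs_le (x i * x l)
    rw [mul_add]
    linarith
  have hsum : ∑ l, P i l * (x i * (x l + x i)) = 0 := by
    have h3 : ∑ l, P i l * x l = -x i := congrFun h i
    have h4 : ∑ l, P i l = 1 := sum_row_of_mem_rowStochastic hP i
    calc ∑ l, P i l * (x i * (x l + x i))
        = x i * (∑ l, P i l * x l) + x i * x i * ∑ l, P i l := by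
          rw [Finset.mul_sum, Finset.mul_sum, ← Finset.sum_add_distrib]
          exact Finset.sum_congr rfl fun l _ => by ring
      _ = 0 := by rw [h3, h4]; ring
  have hz := (Finset.sum_eq_zero_iff_of_nonneg hnn).1 hsum j (Finset.mem_univ j)
  have := ((mul_eq_zero.1 hz).resolve_left hij.ne')
  linarith [(mul_eq_zero.1 this).resolve_left (hne i)]

theorem vecMul_mem_stdSimplex {P : Matrix V V ℝ} (hP : P ∈ rowStochastic ℝ V) {f : V → ℝ}
    (hf : f ∈ stdSimplex ℝ V) : f ᵥ* P ∈ stdSimplex ℝ V := by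
  refine ⟨nonneg_vecMul_of_mem_rowStochastic hP hf.1, ?_⟩
  have := vecMul_dotProduct_one_eq_one_rowStochastic hP (x := f) (by rw [dotProduct_one, hf.2])
  rwa [dotProduct_one] at this

theorem vecMul_pow_stationary {P : Matrix V V ℝ} {p : V → ℝ} (hp : p ᵥ* P = p) (k : ℕ) :
    p ᵥ* (P ^ k) = p := by
  induction k with
  | zero => simp
  | succ k ih => rw [pow_succ, ← vecMul_vecMul, ih, hp]

end Stochastic

/-! ### Strict Hoeffding inequality -/

section Chernoff

variable {Ω : Type uΩ} [MeasurableSpace Ω] {μ : Measure Ω} [IsProbabilityMeasure μ]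

/-- The Chernoff bound for a sub-Gaussian variable is strict for the event of a strict excess: in
Markov's inequality for `exp (t S)` the discarded part of the expectation is positive. -/
theorem measureReal_lt_lt_exp {S : Ω → ℝ} {c : NNReal} (hS : HasSubgaussianMGF S c μ)
    (hm : Measurable S) (hc : 0 < c) (ε : ℝ) (hε : 0 < ε) :
    μ.real {ω | ε < S ω} < Real.exp (-ε ^ 2 / (2 * c)) := by
  have hc' : (0 : ℝ) < c := hc
  -- `t` minimises the exponent `c t² / 2 - t ε`
  set t : ℝ := ε / c with ht
  have htpos : 0 < t := by positivity
  have hset : MeasurableSet {ω | ε < S ω} := measurableSet_lt measurable_const hm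
  have hint := hS.integrable_exp_mul t
  have hind : Integrable ({ω | ε < S ω}.indicator fun _ => Real.exp (t * ε)) μ :=
    (integrable_const _).indicator hset
  have hpos : ∀ ω, 0 < Real.exp (t * S ω) -
      {ω | ε < S ω}.indicator (fun _ => Real.exp (t * ε)) ω := by
    intro ω
    by_cases h : ε < S ω
    · rw [Set.indicator_of_mem (by exact h), sub_pos, Real.exp_lt_exp]
      exact mul_lt_mul_of_pos_left h htpos
    · rw [Set.indicator_of_notMem (by exact h), sub_zero]
      exact Real.exp_pos _
  have hlt : 0 < ∫ ω, (Real.exp (t * S ω) -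
      {ω | ε < S ω}.indicator (fun _ => Real.exp (t * ε)) ω) ∂μ := by
    rw [integral_pos_iff_support_of_nonneg (fun ω => (hpos ω).le) (hint.sub hind)]
    have : Function.support (fun ω => Real.exp (t * S ω) -
        {ω | ε < S ω}.indicator (fun _ => Real.exp (t * ε)) ω) = Set.univ :=
      Set.eq_univ_of_forall fun ω => (hpos ω).ne'
    rw [this]
    simp
  rw [integral_sub hint hind, integral_indicator_const _ hset, smul_eq_mul, sub_pos] at hlt
  have h1 : μ.real {ω | ε < S ω} * Real.exp (t * ε) < Real.exp (c * t ^ 2 / 2) :=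
    hlt.trans_le (hS.mgf_le t)
  rw [← lt_div_iff₀ (Real.exp_pos _), ← Real.exp_sub] at h1
  refine h1.trans_eq (congrArg Real.exp ?_)
  rw [ht]
  field_simp
  ring

/-- Two-sided Hoeffding inequality, with strict inequality, for the mean of independent random
variables with values in `[0, 1]`. -/
theorem measureReal_abs_mean_sub_lt {N : ℕ} (hN : 1 ≤ N) {Z : Fin N → Ω → ℝ}
    (hind : iIndepFun Z μ) (hm : ∀ n, Measurable (Z n)) (hb : ∀ n ω, Z n ω ∈ Set.Icc (0 : ℝ) 1)
    {t : ℝ} (ht : 0 < t) :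
    μ.real {ω | t < |1 / (N : ℝ) * ∑ n, Z n ω - 1 / (N : ℝ) * ∑ n, ∫ ω, Z n ω ∂μ|} <
      2 * Real.exp (-2 * (N : ℝ) * t ^ 2) := by
  have hN' : (0 : ℝ) < N := by exact_mod_cast hN
  set Y : Fin N → Ω → ℝ := fun n ω => Z n ω - ∫ ω, Z n ω ∂μ with hY
  have hYind : iIndepFun Y μ :=
    hind.comp (fun n x => x - ∫ ω, Z n ω ∂μ) fun n => measurable_id.sub_const _
  have hsub : HasSubgaussianMGF (fun ω => ∑ n, Y n ω)
      (∑ _n : Fin N, (‖(1 : ℝ) - 0‖₊ / 2) ^ 2) μ :=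
    HasSubgaussianMGF.sum_of_iIndepFun hYind fun n _ =>
      hasSubgaussianMGF_of_mem_Icc (hm n).aemeasurable (ae_of_all _ (hb n))
  set c : NNReal := ∑ _n : Fin N, (‖(1 : ℝ) - 0‖₊ / 2) ^ 2 with hc
  have hcval : (c : ℝ) = N / 4 := by
    rw [hc]
    simp
    ring
  have hcpos : 0 < c := by
    rw [← NNReal.coe_pos, hcval]
    positivity
  have hYm : Measurable fun ω => ∑ n, Y n ω :=
    Finset.measurable_sum _ fun n _ => (hm n).sub_const _
  have hexp : -(N * t) ^ 2 / (2 * (c : ℝ)) = -2 * (N : ℝ) * t ^ 2 := by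
    rw [hcval]
    field_simp
    ring
  have h1 := measureReal_lt_lt_exp hsub hYm hcpos (N * t) (by positivity)
  have h2 := measureReal_lt_lt_exp hsub.neg hYm.neg hcpos (N * t) (by positivity)
  rw [hexp] at h1 h2
  have hincl : {ω | t < |1 / (N : ℝ) * ∑ n, Z n ω - 1 / (N : ℝ) * ∑ n, ∫ ω, Z n ω ∂μ|} ⊆
      {ω | N * t < ∑ n, Y n ω} ∪ {ω | N * t < (-fun ω => ∑ n, Y n ω) ω} := by
    intro ω hω
    have he : 1 / (N : ℝ) * ∑ n, Z n ω - 1 / (N : ℝ) * ∑ n, ∫ ω, Z n ω ∂μ =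
        (∑ n, Y n ω) / N := by
      rw [hY, Finset.sum_sub_distrib]
      ring
    rw [Set.mem_ofPred_eq, he, lt_abs, ← neg_div, lt_div_iff₀ hN', lt_div_iff₀ hN',
      mul_comm t] at hω
    exact hω
  calc _ ≤ _ := measureReal_mono hincl
    _ ≤ _ := measureReal_union_le _ _
    _ < _ := by linarith

end Chernoff

/-! ### Marginals of a random walk -/

section Walk

open Matrix

variable {V : Type uV} [Fintype V] [DecidableEq V] {Ω : Type uΩ} [MeasurableSpace Ω]
  {μ : Measure Ω} [IsProbabilityMeasure μ]

theorem measureReal_eq_sum_inter {W : Type*} [Fintype W] {Z : Ω → W}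
    (hZ : ∀ b, MeasurableSet (Z ⁻¹' {b})) (E : Set Ω) :
    μ.real E = ∑ b, μ.real (E ∩ Z ⁻¹' {b}) := by
  have h := sum_measureReal_preimage_singleton (μ := μ.restrict E) (f := Z) Finset.univ
    fun b _ => hZ b
  rw [Finset.coe_univ, Set.preimage_univ, measureReal_restrict_apply MeasurableSet.univ,
    Set.univ_inter] at h
  rw [← h]
  exact Finset.sum_congr rfl fun b _ => by
    rw [measureReal_restrict_apply (hZ b), Set.inter_comm]

variable [MeasurableSpace V] [MeasurableSingletonClass V] {P : Matrix V V ℝ} {f : V → ℝ} {L : ℕ}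
  {Y : ℕ → Ω → V}

namespace IsRandomWalk

theorem measurableSet_eq {V : Type uV} [MeasurableSpace V] [MeasurableSingletonClass V]
    {Ω : Type uΩ} [MeasurableSpace Ω] {μ : Measure Ω} {P : Matrix V V ℝ} {f : V → ℝ} {L : ℕ}
    {Y : ℕ → Ω → V} (h : IsRandomWalk μ P f L Y) {i : ℕ} (hi : i < L) (a : V) :
    MeasurableSet (Y i ⁻¹' {a}) :=
  h.measurable i hi (measurableSet_singleton a)

/-- The law of an initial segment of the walk. -/
theorem law_prefix (h : IsRandomWalk μ P f L Y) (hP : P ∈ rowStochastic ℝ V) (k : ℕ) (hk : k < L)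
    (x : ℕ → V) :
    μ.real {ω | ∀ i ≤ k, Y i ω = x i} = f (x 0) * ∏ i ∈ Finset.range k, P (x i) (x (i + 1)) := by
  obtain ⟨d, rfl⟩ : ∃ d, L = k + d + 1 := ⟨L - k - 1, by omega⟩
  induction d generalizing k x with
  | zero => simpa [Nat.lt_succ_iff] using h.law x
  | succ d ih =>
    rw [measureReal_eq_sum_inter (h.measurableSet_eq (i := k + 1) (by omega))]
    have key : ∀ b, μ.real ({ω | ∀ i ≤ k, Y i ω = x i} ∩ Y (k + 1) ⁻¹' {b}) =
        f (x 0) * (∏ i ∈ Finset.range k, P (x i) (x (i + 1))) * P (x k) b := by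
      intro b
      have hx : ∀ i ≤ k, Function.update x (k + 1) b i = x i := fun i hi =>
        Function.update_of_ne (by omega) _ _
      have he : {ω | ∀ i ≤ k, Y i ω = x i} ∩ Y (k + 1) ⁻¹' {b} =
          {ω | ∀ i ≤ k + 1, Y i ω = Function.update x (k + 1) b i} := by
        ext ω
        simp only [Set.mem_inter_iff, Set.mem_ofPred_eq, Set.mem_preimage, Set.mem_singleton_iff]
        constructor
        · rintro ⟨h1, h2⟩ i hi
          rcases Nat.lt_or_ge k i with hki | hki
          · obtain rfl : i = k + 1 := by omega
            rw [h2, Function.update_self]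
          · rw [h1 i hki, hx i hki]
        · intro h1
          exact ⟨fun i hi => by rw [h1 i (by omega), hx i hi],
            by rw [h1 (k + 1) le_rfl, Function.update_self]⟩
      rw [he]
      have := ih (k + 1) (Function.update x (k + 1) b)
        (by rwa [show k + 1 + d + 1 = k + (d + 1) + 1 by omega]) (by omega)
      rw [this, Finset.prod_range_succ, hx 0 (by omega), hx k le_rfl, Function.update_self,
        ← mul_assoc]
      congr 2
      refine Finset.prod_congr rfl fun i hi => ?_
      rw [Finset.mem_range] at hi
      rw [hx i (by omega), hx (i + 1) (by omega)]
    simp only [key, ← Finset.mul_sum, sum_row_of_mem_rowStochastic hP, mul_one]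

/-- The Markov property, with an earlier position of the walk prescribed. -/
theorem measureReal_step (h : IsRandomWalk μ P f L Y) (hP : P ∈ rowStochastic ℝ V) {j k : ℕ}
    (hjk : j ≤ k) (hk : k + 1 < L) (a c b : V) :
    μ.real ({ω | Y j ω = a ∧ Y k ω = c} ∩ Y (k + 1) ⁻¹' {b}) =
      μ.real {ω | Y j ω = a ∧ Y k ω = c} * P c b := by
  set Z : Ω → Fin (k + 1) → V := fun ω i => Y i ω with hZdef
  have hZ : ∀ z, MeasurableSet (Z ⁻¹' {z}) := fun z => by
    have : Measurable Z := measurable_pi_lambda _ fun i => h.measurable i (by omega)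
    exact this (measurableSet_singleton z)
  rw [measureReal_eq_sum_inter hZ, measureReal_eq_sum_inter hZ {ω | Y j ω = a ∧ Y k ω = c},
    Finset.sum_mul]
  refine Finset.sum_congr rfl fun z _ => ?_
  have hmem : ∀ ω, ω ∈ Z ⁻¹' {z} → ∀ i (hi : i < k + 1), Y i ω = z ⟨i, hi⟩ := fun ω hω i hi =>
    congrFun (Set.mem_singleton_iff.1 hω) ⟨i, hi⟩
  by_cases hz : z ⟨j, by omega⟩ = a ∧ z ⟨k, by omega⟩ = c
  · set x : ℕ → V := fun i => if hi : i < k + 1 then z ⟨i, hi⟩ else b with hx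
    have hx1 : ∀ i (hi : i < k + 1), x i = z ⟨i, hi⟩ := fun i hi => dif_pos hi
    have hx2 : x (k + 1) = b := dif_neg (lt_irrefl _)
    have hZx : ∀ ω, ω ∈ Z ⁻¹' {z} ↔ ∀ i ≤ k, Y i ω = x i := fun ω => by
      constructor
      · intro hω i hi
        rw [hmem ω hω i (by omega), hx1]
      · intro hω
        exact Set.mem_singleton_iff.2 (funext fun i => by
          rw [hZdef]
          exact (hω i (by omega)).trans (hx1 i i.2))
    have e1 : {ω | Y j ω = a ∧ Y k ω = c} ∩ Z ⁻¹' {z} = {ω | ∀ i ≤ k, Y i ω = x i} := by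
      ext ω
      rw [Set.mem_inter_iff, hZx, Set.mem_ofPred_eq, Set.mem_ofPred_eq, and_iff_right_iff_imp]
      intro hω
      rw [hω j hjk, hω k le_rfl, hx1 j (by omega), hx1 k (by omega)]
      exact hz
    have e2 : {ω | Y j ω = a ∧ Y k ω = c} ∩ Y (k + 1) ⁻¹' {b} ∩ Z ⁻¹' {z} =
        {ω | ∀ i ≤ k + 1, Y i ω = x i} := by
      rw [Set.inter_right_comm, e1]
      ext ω
      simp only [Set.mem_inter_iff, Set.mem_ofPred_eq, Set.mem_preimage, Set.mem_singleton_iff]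
      constructor
      · rintro ⟨h1, h2⟩ i hi
        rcases Nat.lt_or_ge k i with hki | hki
        · obtain rfl : i = k + 1 := by omega
          rw [h2, hx2]
        · exact h1 i hki
      · intro h1
        exact ⟨fun i hi => h1 i (by omega), by rw [h1 (k + 1) le_rfl, hx2]⟩
    rw [e1, e2, h.law_prefix hP k (by omega), h.law_prefix hP (k + 1) hk, Finset.prod_range_succ,
      hx2, hx1 k (by omega), hz.2, mul_assoc]
  · have e1 : {ω | Y j ω = a ∧ Y k ω = c} ∩ Z ⁻¹' {z} = ∅ := by
      rw [Set.eq_empty_iff_forall_notMem]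
      rintro ω ⟨h1, h2⟩
      exact hz ⟨(hmem ω h2 j (by omega)).symm.trans h1.1, (hmem ω h2 k (by omega)).symm.trans h1.2⟩
    rw [Set.inter_right_comm, e1]
    simp

theorem measureReal_and (h : IsRandomWalk μ P f L Y) (hP : P ∈ rowStochastic ℝ V) {j r : ℕ}
    (hr : j + r < L) (a b : V) :
    μ.real {ω | Y j ω = a ∧ Y (j + r) ω = b} = μ.real {ω | Y j ω = a} * (P ^ r) a b := by
  induction r generalizing b with
  | zero =>
    rcases eq_or_ne a b with rfl | hab
    · simp
    · have : {ω | Y j ω = a ∧ Y (j + 0) ω = b} = ∅ := by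
        rw [Set.eq_empty_iff_forall_notMem]
        rintro ω ⟨h1, h2⟩
        exact hab (h1.symm.trans h2)
      rw [this]
      simp [hab]
  | succ r ih =>
    rw [measureReal_eq_sum_inter (h.measurableSet_eq (i := j + r) (by omega)), pow_succ, mul_apply,
      Finset.mul_sum]
    refine Finset.sum_congr rfl fun c _ => ?_
    rw [← mul_assoc, ← ih (by omega), ← h.measureReal_step hP (by omega) (by omega)]
    congr 1
    ext ω
    simp only [Set.mem_inter_iff, Set.mem_ofPred_eq, Set.mem_preimage, Set.mem_singleton_iff,
      ← add_assoc]
    tauto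

theorem measureReal_eq (h : IsRandomWalk μ P f L Y) (hP : P ∈ rowStochastic ℝ V) {k : ℕ}
    (hk : k < L) (b : V) : μ.real {ω | Y k ω = b} = (f ᵥ* P ^ k) b := by
  rw [measureReal_eq_sum_inter (h.measurableSet_eq (i := 0) (by omega))]
  refine Finset.sum_congr rfl fun a _ => ?_
  have h0 : μ.real {ω | Y 0 ω = a} = f a := by
    simpa using h.law_prefix hP 0 (by omega) fun _ => a
  rw [← h0, ← h.measureReal_and hP (by omega)]
  congr 1
  ext ω
  simp [and_comm]

end IsRandomWalk

end Walk

/-! ### Pair frequencies of a corpus -/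

noncomputable section Frequency

open Matrix

variable {V : Type uV} [Fintype V] [DecidableEq V]

/-- The relative frequency of the pair `(v, c)` among the `2 T (L - T)` pairs contributed to the
corpus by the single walk `y`. -/
def walkFreq (L T : ℕ) (v c : V) (y : ℕ → V) : ℝ :=
  1 / (((L - T : ℕ) : ℝ) * (2 * T)) * ∑ j ∈ Finset.range (L - T), ∑ r ∈ Finset.Icc 1 T,
    ((if y j = v ∧ y (j + r) = c then 1 else 0) + (if y j = c ∧ y (j + r) = v then 1 else 0))

theorem card_corpus {V : Type uV} (L T N : ℕ) (x : Fin N → ℕ → V) :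
    (corpus L T N x).card = N * ((L - T) * (2 * T)) := by
  simp [corpus, Multiset.card_sum, mul_comm T]

theorem count_pair {V : Type uV} [DecidableEq V] (v c a b : V) :
    Multiset.count (v, c) ({(a, b), (b, a)} : Multiset (V × V)) =
      (if a = v ∧ b = c then 1 else 0) + (if a = c ∧ b = v then 1 else 0) := by
  rw [Multiset.insert_eq_cons, Multiset.count_cons, Multiset.count_singleton, add_comm]
  simp only [Prod.mk.injEq, eq_comm (a := v), eq_comm (a := c), and_comm (a := b = v)]

theorem pairFreq_eq {V : Type uV} [DecidableEq V] (L T N : ℕ) (x : Fin N → ℕ → V) (v c : V) :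
    pairFreq L T N x v c = 1 / (N : ℝ) * ∑ n, walkFreq L T v c (x n) := by
  rw [pairFreq, card_corpus]
  simp only [walkFreq, corpus, Multiset.count_sum', count_pair]
  push_cast
  rw [← Finset.mul_sum, one_div_mul_eq_div, one_div_mul_eq_div, div_div, mul_comm (N : ℝ)]

theorem walkFreq_congr {V : Type uV} [DecidableEq V] {L T : ℕ} (v c : V) {y z : ℕ → V}
    (h : ∀ i < L, y i = z i) :
    walkFreq L T v c y = walkFreq L T v c z := by
  unfold walkFreq
  congr 1
  refine Finset.sum_congr rfl fun j hj => Finset.sum_congr rfl fun r hr => ?_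
  rw [Finset.mem_range] at hj
  rw [Finset.mem_Icc] at hr
  rw [h j (by omega), h (j + r) (by omega)]

theorem walkFreq_mem_Icc {V : Type uV} [DecidableEq V] (L T : ℕ) (v c : V) (y : ℕ → V) :
    walkFreq L T v c y ∈ Set.Icc (0 : ℝ) 1 := by
  have h0 : ∀ a b : V, (0 : ℝ) ≤
      (if a = v ∧ b = c then 1 else 0) + (if a = c ∧ b = v then 1 else 0) :=
    fun a b => by positivity
  refine ⟨mul_nonneg (by positivity) (Finset.sum_nonneg fun j _ => Finset.sum_nonneg fun r _ =>
    h0 _ _), ?_⟩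
  have hsum : ∑ j ∈ Finset.range (L - T), ∑ r ∈ Finset.Icc 1 T,
      ((if y j = v ∧ y (j + r) = c then (1 : ℝ) else 0) +
        (if y j = c ∧ y (j + r) = v then 1 else 0)) ≤ ((L - T : ℕ) : ℝ) * (2 * T) := by
    refine (Finset.sum_le_sum fun j _ => Finset.sum_le_sum (g := fun _ => (2 : ℝ)) fun r _ =>
      ?_).trans_eq ?_
    · split_ifs <;> norm_num
    · simp [mul_comm (T : ℝ)]
  unfold walkFreq
  rw [one_div_mul_eq_div]
  exact div_le_one_of_le₀ hsum (by positivity)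

theorem windowAverage_mono {w : Matrix V V ℝ} (hw : w.IsIrreducible) (T : ℕ) {a b : V → ℝ}
    (h : a ≤ b) (v c : V) : windowAverage w T a v c ≤ windowAverage w T b v c := by
  refine mul_le_mul_of_nonneg_left (Finset.sum_le_sum fun r _ => ?_) (by positivity)
  have hr := pow_mem (transition_mem_rowStochastic hw) r
  exact add_le_add (mul_le_mul_of_nonneg_right (h v) (hr.1 v c))
    (mul_le_mul_of_nonneg_right (h c) (hr.1 c v))

theorem windowAverage_sub (w : Matrix V V ℝ) (T : ℕ) (a b : V → ℝ) (v c : V) :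
    windowAverage w T (a - b) v c = windowAverage w T a v c - windowAverage w T b v c := by
  simp only [windowAverage, ← mul_sub, ← Finset.sum_sub_distrib, Pi.sub_apply]
  congr 1
  exact Finset.sum_congr rfl fun r _ => by ring

theorem windowAverage_smul (w : Matrix V V ℝ) (T : ℕ) (k : ℝ) (a : V → ℝ) (v c : V) :
    windowAverage w T (k • a) v c = k * windowAverage w T a v c := by
  simp only [windowAverage, mul_left_comm k, Finset.mul_sum, Pi.smul_apply, smul_eq_mul]
  exact Finset.sum_congr rfl fun r _ => by ring

theorem abs_windowAverage_le {w : Matrix V V ℝ} (hw : w.IsIrreducible) (T : ℕ) {a b : V → ℝ}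
    (h : ∀ v, |a v| ≤ b v) (v c : V) : |windowAverage w T a v c| ≤ windowAverage w T b v c := by
  rw [abs_le]
  refine ⟨?_, windowAverage_mono hw T (fun v => (le_abs_self _).trans (h v)) v c⟩
  have h1 : windowAverage w T ((-1 : ℝ) • b) v c ≤ windowAverage w T a v c :=
    windowAverage_mono hw T (fun v => by
      rw [Pi.smul_apply, smul_eq_mul, neg_one_mul]
      exact (neg_le_neg (h v)).trans (neg_abs_le _)) v c
  rwa [windowAverage_smul, neg_one_mul] at h1

theorem windowAverage_one_le_one {w : Matrix V V ℝ} (hw : w.IsIrreducible) (T : ℕ) (v c : V) :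
    windowAverage w T (fun _ => 1) v c ≤ 1 := by
  have h : ∑ r ∈ Finset.Icc 1 T, (1 * (transition w ^ r) v c + 1 * (transition w ^ r) c v) ≤
      2 * T := by
    refine (Finset.sum_le_sum (g := fun _ => (2 : ℝ)) fun r _ => ?_).trans_eq (by
      simp [mul_comm (T : ℝ)])
    have hr := pow_mem (transition_mem_rowStochastic hw) r
    linarith [le_one_of_mem_rowStochastic hr (i := v) (j := c),
      le_one_of_mem_rowStochastic hr (i := c) (j := v)]
  unfold windowAverage
  rw [one_div_mul_eq_div]
  exact div_le_one_of_le₀ h (by positivity)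

variable {Ω : Type uΩ} [MeasurableSpace Ω] {μ : Measure Ω} [IsProbabilityMeasure μ]
  [MeasurableSpace V] [MeasurableSingletonClass V] {w : Matrix V V ℝ} {f : V → ℝ} {L T : ℕ}

theorem IsRandomWalk.integral_ite {P : Matrix V V ℝ} {Y : ℕ → Ω → V}
    (h : IsRandomWalk μ P f L Y) (hP : P ∈ rowStochastic ℝ V)
    {j r : ℕ} (hr : j + r < L) (a b : V) :
    Integrable (fun ω => if Y j ω = a ∧ Y (j + r) ω = b then (1 : ℝ) else 0) μ ∧
      ∫ ω, (if Y j ω = a ∧ Y (j + r) ω = b then (1 : ℝ) else 0) ∂μ =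
        (f ᵥ* P ^ j) a * (P ^ r) a b := by
  have hset : MeasurableSet {ω | Y j ω = a ∧ Y (j + r) ω = b} :=
    (h.measurableSet_eq (i := j) (by omega) a).inter (h.measurableSet_eq hr b)
  have he : (fun ω => if Y j ω = a ∧ Y (j + r) ω = b then (1 : ℝ) else 0) =
      {ω | Y j ω = a ∧ Y (j + r) ω = b}.indicator fun _ => 1 := by
    ext ω
    simp [Set.indicator_apply]
  rw [he]
  refine ⟨(integrable_const _).indicator hset, ?_⟩
  rw [integral_indicator_const _ hset, smul_eq_mul, mul_one, h.measureReal_and hP hr,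
    h.measureReal_eq hP (by omega)]

theorem integral_walkFreq (hw : w.IsIrreducible) (hTL : T < L) {Y : ℕ → Ω → V}
    (h : IsRandomWalk μ (transition w) f L Y) (v c : V) :
    ∫ ω, walkFreq L T v c (fun i => Y i ω) ∂μ = windowAverage w T
      ((1 / ((L : ℝ) - T)) • fun a => ∑ j ∈ Finset.range (L - T), (f ᵥ* transition w ^ j) a)
        v c := by
  have hP := transition_mem_rowStochastic hw
  have hI : ∀ j ∈ Finset.range (L - T), ∀ r ∈ Finset.Icc 1 T, ∀ a b : V,
      Integrable (fun ω => if Y j ω = a ∧ Y (j + r) ω = b then (1 : ℝ) else 0) μ ∧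
      ∫ ω, (if Y j ω = a ∧ Y (j + r) ω = b then (1 : ℝ) else 0) ∂μ =
        (f ᵥ* transition w ^ j) a * (transition w ^ r) a b := by
    intro j hj r hr a b
    rw [Finset.mem_range] at hj
    rw [Finset.mem_Icc] at hr
    exact h.integral_ite hP (by omega) a b
  have hadd : ∀ j ∈ Finset.range (L - T), ∀ r ∈ Finset.Icc 1 T,
      Integrable (fun ω => (if Y j ω = v ∧ Y (j + r) ω = c then (1 : ℝ) else 0) +
        if Y j ω = c ∧ Y (j + r) ω = v then (1 : ℝ) else 0) μ := fun j hj r hr =>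
    (hI j hj r hr v c).1.add (hI j hj r hr c v).1
  unfold walkFreq
  rw [integral_const_mul, integral_finsetSum _ fun j hj =>
    integrable_finsetSum _ fun r hr => hadd j hj r hr, windowAverage_smul]
  have hcast : ((L - T : ℕ) : ℝ) = (L : ℝ) - T := Nat.cast_sub hTL.le
  have hint : ∀ j ∈ Finset.range (L - T), ∫ ω, ∑ r ∈ Finset.Icc 1 T,
      ((if Y j ω = v ∧ Y (j + r) ω = c then (1 : ℝ) else 0) +
        if Y j ω = c ∧ Y (j + r) ω = v then (1 : ℝ) else 0) ∂μ =
      ∑ r ∈ Finset.Icc 1 T, ((f ᵥ* transition w ^ j) v * (transition w ^ r) v c +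
        (f ᵥ* transition w ^ j) c * (transition w ^ r) c v) := fun j hj => by
    rw [integral_finsetSum _ fun r hr => hadd j hj r hr]
    refine Finset.sum_congr rfl fun r hr => ?_
    rw [integral_add (hI j hj r hr v c).1 (hI j hj r hr c v).1, (hI j hj r hr v c).2,
      (hI j hj r hr c v).2]
  rw [Finset.sum_congr rfl hint, Finset.sum_comm, hcast, windowAverage,
    ← mul_assoc (1 / ((L : ℝ) - T)), one_div_mul_one_div]
  simp only [Finset.sum_mul, Finset.sum_add_distrib]

/-- Concentration follows from a bound on the bias: the pair frequency is the mean of `N`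
independent `[0, 1]`-valued variables, whose common expectation is the first term in `hU`. -/
theorem concentratesWith_of_bias_le (hw : w.IsIrreducible) {p : V → ℝ} (hTL : T < L) {v c : V}
    {U : ℝ} (hU : |windowAverage w T ((1 / ((L : ℝ) - T)) • fun a =>
      ∑ j ∈ Finset.range (L - T), (f ᵥ* transition w ^ j) a) v c - omegaLimit w p T v c| ≤ U) :
    ConcentratesWith.{uΩ} w p f L T v c U := by
  intro Ω _ μ _ N X hN hX
  set E := windowAverage w T ((1 / ((L : ℝ) - T)) • fun a =>
      ∑ j ∈ Finset.range (L - T), (f ᵥ* transition w ^ j) a) v c with hE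
  set Z : Fin N → Ω → ℝ := fun n ω => walkFreq L T v c fun i => X n i ω with hZ
  have hN' : (N : ℝ) ≠ 0 := by
    have : N ≠ 0 := by omega
    exact_mod_cast this
  have hEZ : ∀ n, ∫ ω, Z n ω ∂μ = E := fun n => integral_walkFreq hw hTL (hX.walk n) v c
  -- the frequency of a walk is a function of its first `L` positions
  have hcomp : Z = fun n => (fun y : Fin L → V =>
      walkFreq L T v c fun i => if hi : i < L then y ⟨i, hi⟩ else v) ∘
        fun ω (i : Fin L) => X n i ω := by
    ext n ω
    exact walkFreq_congr v c fun i hi => by simp [hi]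
  have hmeas : ∀ n, Measurable (Z n) := fun n => by
    rw [hcomp]
    exact (measurable_of_finite _).comp
      (measurable_pi_lambda _ fun i => (hX.walk n).measurable i i.2)
  have hind : iIndepFun Z μ := by
    rw [hcomp]
    exact hX.indep.comp _ fun n => measurable_of_finite _
  have hb : ∀ n ω, Z n ω ∈ Set.Icc (0 : ℝ) 1 := fun n ω => walkFreq_mem_Icc L T v c _
  have hmeanE : 1 / (N : ℝ) * ∑ n, ∫ ω, Z n ω ∂μ = E := by
    simp [hEZ, hN']
  have hfreq : ∀ ω, pairFreq L T N (fun n i => X n i ω) v c = 1 / (N : ℝ) * ∑ n, Z n ω := fun ω =>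
    pairFreq_eq L T N _ v c
  simp only [hfreq]
  constructor
  · rw [integral_const_mul, integral_finsetSum _ fun n _ =>
      Integrable.of_mem_Icc 0 1 (hmeas n).aemeasurable (ae_of_all _ (hb n)), hmeanE]
    exact hU
  · intro ε _ hε
    have hH := measureReal_abs_mean_sub_lt hN hind hmeas hb (sub_pos.2 hε)
    rw [hmeanE] at hH
    refine (measureReal_mono fun ω hω => ?_).trans_lt hH
    have h1 := abs_sub_le (1 / (N : ℝ) * ∑ n, Z n ω) E (omegaLimit w p T v c)
    simp only [Set.mem_ofPred_eq] at hω ⊢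
    linarith

/-- Concentration from a bound on the accumulated deviation of the occupation probabilities of
the walk from the stationary distribution. -/
theorem concentratesWith_of_occupation_le (hw : w.IsIrreducible) {p : V → ℝ} (hTL : T < L)
    {B : V → ℝ} (hB : ∀ a, |∑ j ∈ Finset.range (L - T), ((f ᵥ* transition w ^ j) a - p a)| ≤ B a)
    {v c : V} {U : ℝ} (hU : 1 / ((L : ℝ) - T) * windowAverage w T B v c ≤ U) :
    ConcentratesWith.{uΩ} w p f L T v c U := by
  have hcast : ((L - T : ℕ) : ℝ) = (L : ℝ) - T := Nat.cast_sub hTL.le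
  have hpos : 0 < (L : ℝ) - T := sub_pos.2 (by exact_mod_cast hTL)
  refine concentratesWith_of_bias_le hw hTL (le_trans ?_ hU)
  rw [omegaLimit, ← windowAverage_sub, ← windowAverage_smul]
  refine abs_windowAverage_le hw T (fun a => ?_) v c
  have : ((1 / ((L : ℝ) - T)) •
      (fun a => ∑ j ∈ Finset.range (L - T), (f ᵥ* transition w ^ j) a) - p) a =
        1 / ((L : ℝ) - T) * ∑ j ∈ Finset.range (L - T), ((f ᵥ* transition w ^ j) a - p a) := by
    rw [Finset.sum_sub_distrib, Finset.sum_const, Finset.card_range, nsmul_eq_mul, hcast, mul_sub,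
      ← mul_assoc, one_div_mul_cancel hpos.ne', one_mul]
    rfl
  rw [this, abs_mul, abs_of_pos (by positivity : 0 < 1 / ((L : ℝ) - T))]
  exact mul_le_mul_of_nonneg_left (hB a) (by positivity)

end Frequency

/-! ### The Poisson equation of an irreducible chain -/

section Poisson

open Matrix

variable {V : Type uV} [Fintype V] [DecidableEq V]

/-- The Poisson equation `h - P h = 1_v - p v` of an irreducible chain, of any period, is solvable:
the maximum principle makes `1 - P + 𝟙 pᵀ` injective, hence surjective. -/
theorem exists_poisson_solution {P : Matrix V V ℝ} (hP : P ∈ rowStochastic ℝ V)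
    (hirr : P.IsIrreducible) {p : V → ℝ} (hp : IsStationary P p) (v : V) :
    ∃ h : V → ℝ, h - P *ᵥ h = Pi.single v 1 - fun _ => p v := by
  obtain ⟨⟨-, hp1⟩, hpP⟩ := hp
  set M : Matrix V V ℝ := 1 - P + vecMulVec 1 p with hM
  have hMx : ∀ x, M *ᵥ x = x - P *ᵥ x + fun _ => p ⬝ᵥ x := fun x => by
    ext i
    rw [hM, add_mulVec, sub_mulVec, one_mulVec, vecMulVec_mulVec]
    simp
  have hpM : ∀ x, p ⬝ᵥ (M *ᵥ x) = p ⬝ᵥ x := fun x => by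
    rw [hMx, dotProduct_add, dotProduct_sub, dotProduct_mulVec, hpP, sub_self, zero_add]
    simp [dotProduct, ← Finset.sum_mul, hp1]
  have hinj : Function.Injective M.mulVec := by
    rw [← coe_mulVecLin, ← LinearMap.ker_eq_bot, LinearMap.ker_eq_bot']
    intro x hx
    rw [coe_mulVecLin] at hx
    have h0 : p ⬝ᵥ x = 0 := by rw [← hpM x, hx, dotProduct_zero]
    have hPx : P *ᵥ x = x := by
      have := hMx x
      rw [hx, h0] at this
      ext i
      have := congrFun this i
      simp only [Pi.zero_apply, Pi.add_apply, Pi.sub_apply, add_zero] at this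
      linarith
    ext i
    have hconst : ∀ j, x j = x i := fun j => eq_of_le_mulVec hP hirr hPx.ge j i
    simpa [dotProduct, hconst, ← Finset.sum_mul, hp1] using h0
  obtain ⟨h, hh⟩ := (mulVec_surjective_iff_isUnit.2 (mulVec_injective_iff_isUnit.1 hinj))
    (Pi.single v 1)
  have hph : p ⬝ᵥ h = p v := by
    rw [← hpM h, hh]
    simp
  exact ⟨h, by rw [← hh, hMx, hph, add_sub_cancel_right]⟩

theorem abs_dotProduct_le {V : Type uV} [Fintype V] {q : V → ℝ} (hq : q ∈ stdSimplex ℝ V)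
    (h : V → ℝ) :
    |q ⬝ᵥ h| ≤ ∑ a, |h a| := by
  refine (Finset.abs_sum_le_sum_abs _ _).trans (Finset.sum_le_sum fun a _ => ?_)
  rw [abs_mul, abs_of_nonneg (hq.1 a)]
  refine mul_le_of_le_one_left (abs_nonneg _) ?_
  rw [← hq.2]
  exact Finset.single_le_sum (fun b _ => hq.1 b) (Finset.mem_univ a)

/-- The accumulated deviation of the occupation probabilities from the stationary distribution is
bounded uniformly in time and in the starting distribution: it telescopes along a solution of the
Poisson equation. -/
theorem exists_occupation_le {P : Matrix V V ℝ} (hP : P ∈ rowStochastic ℝ V)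
    (hirr : P.IsIrreducible) {p : V → ℝ} (hp : IsStationary P p) :
    ∃ g : ℝ, 0 < g ∧ ∀ f ∈ stdSimplex ℝ V, ∀ (n : ℕ) (a : V),
      |∑ j ∈ Finset.range n, ((f ᵥ* P ^ j) a - p a)| ≤ g := by
  choose h hh using exists_poisson_solution hP hirr hp
  refine ⟨∑ v, 2 * ∑ a, |h v a| + 1,
    add_pos_of_nonneg_of_pos (Finset.sum_nonneg fun v _ => by positivity) one_pos,
    fun f hf n a => ?_⟩
  have hsimp : ∀ j, f ᵥ* P ^ j ∈ stdSimplex ℝ V := fun j => vecMul_mem_stdSimplex (pow_mem hP j) hf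
  have hterm : ∀ j, (f ᵥ* P ^ j) a - p a = (f ᵥ* P ^ j) ⬝ᵥ h a - (f ᵥ* P ^ (j + 1)) ⬝ᵥ h a := by
    intro j
    rw [pow_succ, ← vecMul_vecMul, ← dotProduct_mulVec _ P, ← dotProduct_sub, hh, dotProduct_sub,
      dotProduct_single_one]
    simp [dotProduct, ← Finset.sum_mul, (hsimp j).2]
  simp only [hterm]
  rw [Finset.sum_range_sub']
  have h1 := abs_dotProduct_le (hsimp 0) (h a)
  have h2 := abs_dotProduct_le (hsimp n) (h a)
  have h3 := Finset.single_le_sum (f := fun v => 2 * ∑ a, |h v a|) (fun v _ => by positivity)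
    (Finset.mem_univ a)
  have h4 := abs_sub ((f ᵥ* P ^ 0) ⬝ᵥ h a) ((f ᵥ* P ^ n) ⬝ᵥ h a)
  linarith

end Poisson

/-! ### Geometric convergence of an aperiodic chain -/

section Aperiodic

open Matrix

variable {V : Type uV} [Fintype V] [DecidableEq V]

theorem pow_add_apply_pos {P : Matrix V V ℝ} (hP : P ∈ rowStochastic ℝ V) {m n : ℕ} {i j k : V}
    (h1 : 0 < (P ^ m) i j) (h2 : 0 < (P ^ n) j k) : 0 < (P ^ (m + n)) i k := by
  rw [pow_add, mul_apply]
  exact (mul_pos h1 h2).trans_le (Finset.single_le_sum (f := fun l => (P ^ m) i l * (P ^ n) l k)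
    (fun l _ => mul_nonneg ((pow_mem hP m).1 i l) ((pow_mem hP n).1 l k)) (Finset.mem_univ j))

/-- An irreducible aperiodic chain is primitive. The return times to a vertex form a numerical
semigroup of greatest common divisor `1`, which contains all large integers. -/
theorem exists_pow_all_pos {w : Matrix V V ℝ} (hw : w.IsIrreducible) (ha : IsAperiodic w) :
    ∃ k > 0, ∀ i j, 0 < (transition w ^ k) i j := by
  have hP := transition_mem_rowStochastic hw
  have hev : ∀ i j, ∀ᶠ m in Filter.atTop, 0 < (transition w ^ m) i j := by
    intro i j
    set s : Set ℕ := {n | 0 < n ∧ 0 < (transition w ^ n) i i} with hs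
    have hgcd : Nat.setGcd s = 1 := ha i _ fun n hn hpos => Nat.setGcd_dvd_of_mem ⟨hn, hpos⟩
    obtain ⟨n, hn⟩ := Nat.exists_mem_closure_of_ge s
    have hret : ∀ m ∈ AddSubmonoid.closure s, 0 < (transition w ^ m) i i := fun m hm =>
      AddSubmonoid.closure_induction (motive := fun m _ => 0 < (transition w ^ m) i i)
        (fun _ h => h.2) (by simp) (fun _ _ _ _ h1 h2 => pow_add_apply_pos hP h1 h2) hm
    obtain ⟨k, -, hk⟩ := exists_pow_pos (transition_isIrreducible hw) i j
    filter_upwards [Filter.eventually_ge_atTop (n + k)] with m hm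
    have := pow_add_apply_pos hP (hret (m - k) (hn _ (by omega) (hgcd ▸ one_dvd _))) hk
    rwa [Nat.sub_add_cancel (by omega)] at this
  have hall := Filter.eventually_all.2 fun i => Filter.eventually_all.2 (hev i)
  obtain ⟨k, hk, hpos⟩ := (hall.and (Filter.eventually_gt_atTop 0)).exists
  exact ⟨k, hpos, hk⟩

/-- Doeblin's contraction: a stochastic matrix with entries at least `δ` contracts the `ℓ¹` norm of
row vectors of total mass `0` by `1 - |V| δ`. -/
theorem sum_abs_vecMul_le {Q : Matrix V V ℝ} (hQ : Q ∈ rowStochastic ℝ V) {δ : ℝ}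
    (hδ : ∀ i j, δ ≤ Q i j) {z : V → ℝ} (hz : ∑ i, z i = 0) :
    ∑ j, |(z ᵥ* Q) j| ≤ (1 - Fintype.card V * δ) * ∑ i, |z i| := by
  have h1 : ∀ j, |(z ᵥ* Q) j| ≤ ∑ i, |z i| * (Q i j - δ) := fun j => by
    have : (z ᵥ* Q) j = ∑ i, z i * (Q i j - δ) := by
      simp only [mul_sub, Finset.sum_sub_distrib, ← Finset.sum_mul, hz, zero_mul, sub_zero]
      rfl
    rw [this]
    refine (Finset.abs_sum_le_sum_abs _ _).trans_eq (Finset.sum_congr rfl fun i _ => ?_)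
    rw [abs_mul, abs_of_nonneg (sub_nonneg.2 (hδ i j))]
  calc ∑ j, |(z ᵥ* Q) j| ≤ ∑ j, ∑ i, |z i| * (Q i j - δ) := Finset.sum_le_sum fun j _ => h1 j
    _ = ∑ i, |z i| * ∑ j, (Q i j - δ) := by
      rw [Finset.sum_comm]
      simp only [Finset.mul_sum]
    _ = (1 - Fintype.card V * δ) * ∑ i, |z i| := by
      simp only [Finset.sum_sub_distrib, sum_row_of_mem_rowStochastic hQ, Finset.sum_const,
        Finset.card_univ, nsmul_eq_mul, ← Finset.sum_mul]
      rw [mul_comm]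

theorem sum_vecMul {Q : Matrix V V ℝ} (hQ : Q ∈ rowStochastic ℝ V) (z : V → ℝ) :
    ∑ j, (z ᵥ* Q) j = ∑ i, z i := by
  rw [← dotProduct_one, ← dotProduct_mulVec, one_vecMul_of_mem_rowStochastic hQ, dotProduct_one]

theorem exists_isMixingConstants {w : Matrix V V ℝ} (hw : w.IsIrreducible) (ha : IsAperiodic w)
    {p : V → ℝ} (hp : IsStationary (transition w) p) : ∃ C α : ℝ, IsMixingConstants w p C α := by
  have hP := transition_mem_rowStochastic hw
  set P := transition w with hPdef
  obtain ⟨⟨hp0, hp1⟩, hpP⟩ := hp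
  have hV : Nonempty V := by
    by_contra h
    rw [not_nonempty_iff] at h
    simp at hp1
  obtain ⟨k, hk, hpos⟩ := exists_pow_all_pos hw ha
  obtain ⟨⟨i₀, j₀⟩, -, hmin⟩ := Finset.exists_min_image (Finset.univ : Finset (V × V))
    (fun x => (P ^ k) x.1 x.2) Finset.univ_nonempty
  -- half the least entry, so that the contraction factor is not `0`
  set δ := (P ^ k) i₀ j₀ / 2 with hδ
  have hδpos : 0 < δ := half_pos (hpos i₀ j₀)
  have hδle : ∀ i j, δ ≤ (P ^ k) i j := fun i j =>
    (half_le_self (hpos i₀ j₀).le).trans (hmin (i, j) (Finset.mem_univ _))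
  have hPk := pow_mem hP k
  have hcard : (0 : ℝ) < Fintype.card V := by exact_mod_cast Fintype.card_pos
  have hnδ : Fintype.card V * δ ≤ 1 / 2 := by
    have : ∑ _j : V, (P ^ k) i₀ j₀ ≤ ∑ j, (P ^ k) i₀ j :=
      Finset.sum_le_sum fun j _ => hmin (i₀, j) (Finset.mem_univ _)
    rw [sum_row_of_mem_rowStochastic hPk, Finset.sum_const, Finset.card_univ, nsmul_eq_mul] at this
    rw [hδ]
    linarith
  set ρ := 1 - Fintype.card V * δ with hρ
  have hρ0 : 0 < ρ := by linarith
  have hρ1 : ρ < 1 := by linarith [mul_pos hcard hδpos]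
  set α := ρ ^ (1 / (k : ℝ)) with hα
  have hk' : (k : ℝ) ≠ 0 := by exact_mod_cast hk.ne'
  have hαk : α ^ k = ρ := by
    rw [hα, ← Real.rpow_natCast, ← Real.rpow_mul hρ0.le, one_div_mul_cancel hk', Real.rpow_one]
  have hα0 : 0 < α := Real.rpow_pos_of_pos hρ0 _
  have hα1 : α < 1 := Real.rpow_lt_one hρ0.le hρ1 (by positivity)
  refine ⟨1 / ρ, α, by positivity, hα0, hα1, fun t s => ?_⟩
  set z : V → ℝ := Pi.single s 1 - p with hz
  have hzt : ∀ t, z ᵥ* P ^ t = (P ^ t) s - p := fun t => by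
    rw [hz, sub_vecMul, single_one_vecMul, vecMul_pow_stationary hpP]
    rfl
  have hsum : ∀ t, ∑ j, (z ᵥ* P ^ t) j = 0 := fun t => by
    rw [sum_vecMul (pow_mem hP t), hz]
    simp [hp1]
  have hmono : ∀ t, ∑ j, |(z ᵥ* P ^ t) j| ≤ ∑ i, |z i| := fun t => by
    have := sum_abs_vecMul_le (pow_mem hP t) (δ := 0) (pow_mem hP t).1 (z := z)
      (by simpa using hsum 0)
    simpa using this
  have hcontr : ∀ q r, ∑ j, |(z ᵥ* P ^ (r + k * q)) j| ≤ ρ ^ q * ∑ i, |z i| := by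
    intro q r
    induction q with
    | zero => simpa using hmono r
    | succ q ih =>
      have h := sum_abs_vecMul_le hPk hδle (hsum (r + k * q))
      rw [vecMul_vecMul, ← pow_add] at h
      rw [mul_add, mul_one, ← add_assoc, pow_succ', mul_assoc]
      exact h.trans (mul_le_mul_of_nonneg_left ih hρ0.le)
  have hz2 : ∑ i, |z i| ≤ 2 := by
    refine (Finset.sum_le_sum fun i _ => abs_sub ((Pi.single s 1 : V → ℝ) i) (p i)).trans_eq ?_
    rw [Finset.sum_add_distrib]
    have e1 : ∑ i, |(Pi.single s 1 : V → ℝ) i| = 1 := by simp [Pi.single_apply, apply_ite abs]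
    have e2 : ∑ i, |p i| = 1 := by
      rw [← hp1]
      exact Finset.sum_congr rfl fun i _ => abs_of_nonneg (hp0 i)
    rw [e1, e2]
    norm_num
  have hfin : ρ ^ (t / k) * ρ ≤ α ^ t := by
    have ht : α ^ t = ρ ^ (t / k) * α ^ (t % k) := by
      rw [← hαk, ← pow_mul, ← pow_add, Nat.div_add_mod]
    rw [ht, ← hαk]
    exact mul_le_mul_of_nonneg_left
      (pow_le_pow_of_le_one hα0.le hα1.le (Nat.mod_lt t hk).le) (by positivity)
  have hbound := hcontr (t / k) (t % k)
  rw [Nat.mod_add_div, hzt] at hbound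
  have h2 : ρ ^ (t / k) ≤ 1 / ρ * α ^ t := by
    rw [one_div_mul_eq_div, le_div_iff₀ hρ0]
    exact hfin
  have h3 : ρ ^ (t / k) * ∑ i, |z i| ≤ ρ ^ (t / k) * 2 :=
    mul_le_mul_of_nonneg_left hz2 (by positivity)
  unfold tvDist
  simp only [Pi.sub_apply] at hbound
  linarith

theorem abs_sub_le_tvDist {q p : V → ℝ} (hq : q ∈ stdSimplex ℝ V) (hp : p ∈ stdSimplex ℝ V)
    (a : V) : |q a - p a| ≤ tvDist q p := by
  have h0 : q a - p a + ∑ x ∈ Finset.univ.erase a, (q x - p x) = 0 := by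
    rw [Finset.add_sum_erase _ (fun x => q x - p x) (Finset.mem_univ a), Finset.sum_sub_distrib,
      hq.2, hp.2, sub_self]
  have h1 : |q a - p a| ≤ ∑ x ∈ Finset.univ.erase a, |q x - p x| := by
    rw [eq_neg_of_add_eq_zero_left h0, abs_neg]
    exact Finset.abs_sum_le_sum_abs _ _
  have h2 := Finset.add_sum_erase _ (fun x => |q x - p x|) (Finset.mem_univ a)
  unfold tvDist
  linarith

theorem vecMul_sub_eq_sum {V : Type uV} [Fintype V] {f p : V → ℝ} (hf : f ∈ stdSimplex ℝ V)
    (Q : Matrix V V ℝ) (a : V) :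
    (f ᵥ* Q) a - p a = ∑ s, f s * (Q s a - p a) := by
  simp only [mul_sub, Finset.sum_sub_distrib, ← Finset.sum_mul, hf.2, one_mul]
  rfl

theorem occupation_le_of_isMixingConstants {w : Matrix V V ℝ} (hw : w.IsIrreducible)
    {p : V → ℝ} (hp : IsStationary (transition w) p) {C α : ℝ} (hC : IsMixingConstants w p C α)
    {f : V → ℝ} (hf : f ∈ stdSimplex ℝ V) (n : ℕ) (a : V) :
    |∑ j ∈ Finset.range n, ((f ᵥ* transition w ^ j) a - p a)| ≤ C * ((1 - α ^ n) / (1 - α)) := by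
  obtain ⟨-, -, hα1, hmix⟩ := hC
  have hP := transition_mem_rowStochastic hw
  have hterm : ∀ j, |(f ᵥ* transition w ^ j) a - p a| ≤ C * α ^ j := fun j => by
    rw [vecMul_sub_eq_sum hf]
    calc |∑ s, f s * ((transition w ^ j) s a - p a)|
        ≤ ∑ s, |f s * ((transition w ^ j) s a - p a)| := Finset.abs_sum_le_sum_abs _ _
      _ ≤ ∑ s, f s * (C * α ^ j) := Finset.sum_le_sum fun s _ => by
          rw [abs_mul, abs_of_nonneg (hf.1 s)]
          refine mul_le_mul_of_nonneg_left ((abs_sub_le_tvDist ⟨fun i => ?_, ?_⟩ hp.1 a).trans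
            (hmix j s)) (hf.1 s)
          · exact (pow_mem hP j).1 s i
          · exact sum_row_of_mem_rowStochastic (pow_mem hP j) s
      _ = C * α ^ j := by rw [← Finset.sum_mul, hf.2, one_mul]
  refine (Finset.abs_sum_le_sum_abs _ _).trans ((Finset.sum_le_sum fun j _ => hterm j).trans_eq ?_)
  rw [← Finset.mul_sum, geom_sum_eq hα1.ne, ← neg_div_neg_eq, neg_sub, neg_sub]

end Aperiodic

/-! ### Spectral decomposition of a reversible chain -/

noncomputable section Spectral

open Matrix

variable {V : Type uV} [Fintype V] [DecidableEq V] {w : Matrix V V ℝ}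

/-- The `i`-th member of an orthonormal basis of eigenvectors of the normalised Laplacian. -/
def eigvec (hs : w.IsSymm) (i : V) : V → ℝ := (normLaplacian_isHermitian hs).eigenvectorBasis i

/-- The eigenvalue `θ i = 1 - λ` of the transition matrix that corresponds to the eigenvalue `λ` of
the normalised Laplacian at the eigenvector `eigvec hs i`. -/
def walkEigenvalue (hs : w.IsSymm) (i : V) : ℝ := 1 - (normLaplacian_isHermitian hs).eigenvalues i

theorem sum_eigvec_mul_eigvec (hs : w.IsSymm) (a b : V) :
    ∑ i, eigvec hs i a * eigvec hs i b = if a = b then 1 else 0 := by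
  have h := (mem_unitaryGroup_iff (A := ((normLaplacian_isHermitian hs).eigenvectorUnitary :
    Matrix V V ℝ))).1 (normLaplacian_isHermitian hs).eigenvectorUnitary.2
  have h2 := congrFun (congrFun h a) b
  rw [mul_apply, one_apply] at h2
  rw [← h2]
  rfl

theorem eigvec_dotProduct_eigvec (hs : w.IsSymm) (i j : V) :
    eigvec hs i ⬝ᵥ eigvec hs j = if i = j then 1 else 0 := by
  have h := (mem_unitaryGroup_iff' (A := ((normLaplacian_isHermitian hs).eigenvectorUnitary :
    Matrix V V ℝ))).1 (normLaplacian_isHermitian hs).eigenvectorUnitary.2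
  have h2 := congrFun (congrFun h i) j
  rw [mul_apply, one_apply] at h2
  rw [← h2]
  rfl

theorem eigvec_ne_zero (hs : w.IsSymm) (i : V) : eigvec hs i ≠ 0 := fun h => by
  have := eigvec_dotProduct_eigvec hs i i
  simp [h] at this

/-- Orthonormal eigenvectors on a common line coincide. -/
theorem eq_of_eigvec_eq_smul (hs : w.IsSymm) {y : V → ℝ} {i j : V} {a b : ℝ}
    (hi : eigvec hs i = a • y) (hj : eigvec hs j = b • y) : i = j := by
  by_contra hij
  have h1 := eigvec_dotProduct_eigvec hs i i
  have h2 := eigvec_dotProduct_eigvec hs j j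
  have h3 := eigvec_dotProduct_eigvec hs i j
  rw [if_pos rfl, hi, smul_dotProduct, dotProduct_smul, smul_eq_mul, smul_eq_mul] at h1
  rw [if_pos rfl, hj, smul_dotProduct, dotProduct_smul, smul_eq_mul, smul_eq_mul] at h2
  rw [if_neg hij, hi, hj, smul_dotProduct, dotProduct_smul, smul_eq_mul, smul_eq_mul] at h3
  have h4 : (a * (a * (y ⬝ᵥ y))) * (b * (b * (y ⬝ᵥ y))) = (a * (b * (y ⬝ᵥ y))) ^ 2 := by ring
  rw [h1, h2, h3] at h4
  norm_num at h4

/-- The symmetric matrix `D^{1/2} P D^{-1/2}`, conjugate to the transition matrix. -/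
def symTransition (w : Matrix V V ℝ) : Matrix V V ℝ :=
  diagonal (fun i => √(outDegree w i)) * transition w * diagonal (fun i => (√(outDegree w i))⁻¹)

theorem symTransition_eq (w : Matrix V V ℝ) : symTransition w = 1 - normLaplacian w := by
  rw [normLaplacian, sub_sub_cancel, symTransition]

theorem symTransition_mulVec_eigvec (hs : w.IsSymm) (i : V) :
    symTransition w *ᵥ eigvec hs i = walkEigenvalue hs i • eigvec hs i := by
  rw [symTransition_eq, sub_mulVec, one_mulVec, walkEigenvalue, sub_smul, one_smul]
  congr 1
  exact (normLaplacian_isHermitian hs).mulVec_eigenvectorBasis i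

theorem symTransition_pow_mulVec_eigvec (hs : w.IsSymm) (i : V) (k : ℕ) :
    symTransition w ^ k *ᵥ eigvec hs i = walkEigenvalue hs i ^ k • eigvec hs i := by
  induction k with
  | zero => simp
  | succ k ih =>
    rw [pow_succ, ← mulVec_mulVec, symTransition_mulVec_eigvec, mulVec_smul, ih, smul_smul,
      pow_succ']

theorem symTransition_transpose (hs : w.IsSymm) : (symTransition w)ᵀ = symTransition w := by
  have h : (normLaplacian w)ᵀ = normLaplacian w := by
    simpa [Matrix.IsHermitian, conjTranspose_eq_transpose_of_trivial] using
      normLaplacian_isHermitian hs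
  rw [symTransition_eq, transpose_sub, transpose_one, h]

theorem sqrt_outDegree_pos (hw : w.IsIrreducible) (i : V) : 0 < √(outDegree w i) :=
  Real.sqrt_pos.2 (outDegree_pos hw i)

theorem symTransition_pow (hw : w.IsIrreducible) (k : ℕ) :
    symTransition w ^ k = diagonal (fun i => √(outDegree w i)) * transition w ^ k *
      diagonal (fun i => (√(outDegree w i))⁻¹) := by
  have hd : diagonal (fun i => √(outDegree w i)) *
      diagonal (fun i => (√(outDegree w i))⁻¹) = 1 := by
    rw [diagonal_mul_diagonal, ← diagonal_one]
    congr 1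
    ext i
    exact mul_inv_cancel₀ (sqrt_outDegree_pos hw i).ne'
  have hd' : diagonal (fun i => (√(outDegree w i))⁻¹) *
      diagonal (fun i => √(outDegree w i)) = 1 := by
    rw [diagonal_mul_diagonal, ← diagonal_one]
    congr 1
    ext i
    exact inv_mul_cancel₀ (sqrt_outDegree_pos hw i).ne'
  induction k with
  | zero => rw [pow_zero, pow_zero, mul_one, hd]
  | succ k ih =>
    rw [pow_succ, ih, symTransition, pow_succ]
    simp only [Matrix.mul_assoc]
    rw [← Matrix.mul_assoc (diagonal fun i => (√(outDegree w i))⁻¹) (diagonal _), hd',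
      Matrix.one_mul]

/-- The spectral expansion of the transition probabilities of an undirected graph. -/
theorem transition_pow_apply_eq_sum (hw : w.IsIrreducible) (hs : w.IsSymm) (k : ℕ) (s v : V) :
    (transition w ^ k) s v = (√(outDegree w s))⁻¹ * √(outDegree w v) *
      ∑ i, walkEigenvalue hs i ^ k * (eigvec hs i s * eigvec hs i v) := by
  have h1 : (symTransition w ^ k) s v =
      ∑ i, walkEigenvalue hs i ^ k * (eigvec hs i s * eigvec hs i v) := by
    calc (symTransition w ^ k) s v
        = ∑ c, (symTransition w ^ k) s c * ∑ i, eigvec hs i c * eigvec hs i v := by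
          simp [sum_eigvec_mul_eigvec]
      _ = ∑ i, (symTransition w ^ k *ᵥ eigvec hs i) s * eigvec hs i v := by
          simp only [mulVec, dotProduct, Finset.mul_sum, Finset.sum_mul]
          rw [Finset.sum_comm]
          simp only [mul_assoc]
      _ = _ := Finset.sum_congr rfl fun i _ => by
          rw [symTransition_pow_mulVec_eigvec, Pi.smul_apply, smul_eq_mul, mul_assoc]
  rw [← h1, symTransition_pow hw, mul_diagonal, diagonal_mul]
  have hs' := (sqrt_outDegree_pos hw s).ne'
  have hv' := (sqrt_outDegree_pos hw v).ne'
  field_simp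

theorem symTransition_mulVec (hw : w.IsIrreducible) (x : V → ℝ) :
    symTransition w *ᵥ (fun a => √(outDegree w a) * x a) =
      fun a => √(outDegree w a) * (transition w *ᵥ x) a := by
  have hx : diagonal (fun i => (√(outDegree w i))⁻¹) *ᵥ (fun a => √(outDegree w a) * x a) = x := by
    ext a
    rw [mulVec_diagonal, inv_mul_cancel_left₀ (sqrt_outDegree_pos hw a).ne']
  rw [symTransition, ← mulVec_mulVec, ← mulVec_mulVec, hx]
  ext a
  rw [mulVec_diagonal]

/-- The eigenvector `D^{-1/2} u` of the transition matrix obtained from `u = eigvec hs i`. -/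
def walkEigvec (hs : w.IsSymm) (i : V) : V → ℝ := fun a => (√(outDegree w a))⁻¹ * eigvec hs i a

theorem eigvec_eq (hw : w.IsIrreducible) (hs : w.IsSymm) (i : V) :
    eigvec hs i = fun a => √(outDegree w a) * walkEigvec hs i a := by
  ext a
  rw [walkEigvec, mul_inv_cancel_left₀ (sqrt_outDegree_pos hw a).ne']

theorem walkEigvec_ne_zero (hw : w.IsIrreducible) (hs : w.IsSymm) (i : V) :
    walkEigvec hs i ≠ 0 := fun h => eigvec_ne_zero hs i (by
  rw [eigvec_eq hw, h]
  ext a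
  simp)

theorem transition_mulVec_walkEigvec (hw : w.IsIrreducible) (hs : w.IsSymm) (i : V) :
    transition w *ᵥ walkEigvec hs i = walkEigenvalue hs i • walkEigvec hs i := by
  have h := symTransition_mulVec hw (walkEigvec hs i)
  rw [← eigvec_eq hw, symTransition_mulVec_eigvec] at h
  ext a
  have ha := congrFun h a
  rw [Pi.smul_apply, smul_eq_mul] at ha ⊢
  rw [walkEigvec, mul_left_comm, ha, inv_mul_cancel_left₀ (sqrt_outDegree_pos hw a).ne']

theorem exists_walkEigenvalue_eq (hw : w.IsIrreducible) (hs : w.IsSymm) {y : V → ℝ} {θ : ℝ}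
    (hy : y ≠ 0) (h : transition w *ᵥ y = θ • y) : ∃ i, walkEigenvalue hs i = θ := by
  set z : V → ℝ := fun a => √(outDegree w a) * y a with hz
  have hSz : symTransition w *ᵥ z = θ • z := by
    rw [hz, symTransition_mulVec hw, h]
    ext a
    simp [mul_left_comm]
  have hne : ∃ i, eigvec hs i ⬝ᵥ z ≠ 0 := by
    by_contra! h0
    obtain ⟨b, hb⟩ := Function.ne_iff.1 hy
    refine hb ?_
    have hzb : z b = ∑ i, eigvec hs i b * (eigvec hs i ⬝ᵥ z) := by
      simp only [dotProduct, Finset.mul_sum]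
      rw [Finset.sum_comm]
      simp only [← mul_assoc, ← Finset.sum_mul, sum_eigvec_mul_eigvec]
      simp
    simp only [h0, mul_zero, Finset.sum_const_zero] at hzb
    exact (mul_eq_zero.1 hzb).resolve_left (sqrt_outDegree_pos hw b).ne'
  obtain ⟨i, hi⟩ := hne
  refine ⟨i, ?_⟩
  have h1 : eigvec hs i ⬝ᵥ (symTransition w *ᵥ z) = θ * (eigvec hs i ⬝ᵥ z) := by
    rw [hSz, dotProduct_smul, smul_eq_mul]
  rw [dotProduct_mulVec, ← mulVec_transpose, symTransition_transpose hs,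
    symTransition_mulVec_eigvec, smul_dotProduct, smul_eq_mul] at h1
  exact mul_right_cancel₀ hi h1

theorem abs_walkEigenvalue_le_one (hw : w.IsIrreducible) (hs : w.IsSymm) (i : V) :
    |walkEigenvalue hs i| ≤ 1 :=
  abs_eigenvalue_le_one (transition_mem_rowStochastic hw) (walkEigvec_ne_zero hw hs i)
    (transition_mulVec_walkEigvec hw hs i)

theorem eigvec_eq_of_walkEigenvalue_eq_one (hw : w.IsIrreducible) (hs : w.IsSymm) {i : V}
    (hi : walkEigenvalue hs i = 1) :
    ∃ a : ℝ, eigvec hs i = a • fun b => √(outDegree w b) := by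
  have h := transition_mulVec_walkEigvec hw hs i
  rw [hi, one_smul] at h
  refine ⟨walkEigvec hs i i, ?_⟩
  rw [eigvec_eq hw]
  ext b
  rw [Pi.smul_apply, smul_eq_mul, mul_comm, eq_of_le_mulVec (transition_mem_rowStochastic hw)
    (transition_isIrreducible hw) h.ge b i]

theorem exists_walkEigenvalue_eq_one [Nonempty V] (hw : w.IsIrreducible) (hs : w.IsSymm) :
    ∃ i, walkEigenvalue hs i = 1 :=
  exists_walkEigenvalue_eq hw hs (y := 1) one_ne_zero (by
    rw [one_vecMul_of_mem_rowStochastic (transition_mem_rowStochastic hw), one_smul])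

theorem eq_of_walkEigenvalue_eq_one (hw : w.IsIrreducible) (hs : w.IsSymm) {i j : V}
    (hi : walkEigenvalue hs i = 1) (hj : walkEigenvalue hs j = 1) : i = j := by
  obtain ⟨a, ha⟩ := eigvec_eq_of_walkEigenvalue_eq_one hw hs hi
  obtain ⟨b, hb⟩ := eigvec_eq_of_walkEigenvalue_eq_one hw hs hj
  exact eq_of_eigvec_eq_smul hs ha hb

theorem isBipartite_of_walkEigenvalue_eq_neg_one (hw : w.IsIrreducible) (hs : w.IsSymm) {i : V}
    (hi : walkEigenvalue hs i = -1) : IsBipartite w := by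
  have h := transition_mulVec_walkEigvec hw hs i
  rw [hi, neg_one_smul] at h
  obtain ⟨hne, hneg⟩ := eq_neg_of_mulVec_eq_neg (transition_mem_rowStochastic hw)
    (transition_isIrreducible hw) (walkEigvec_ne_zero hw hs i) h
  refine ⟨fun a => decide (0 < walkEigvec hs i a), fun a b hab heq => ?_⟩
  have h1 := hneg a b ((transition_pos_iff hw).2 hab)
  rw [decide_eq_decide, h1, neg_pos] at heq
  rcases lt_or_gt_of_ne (hne a) with h2 | h2
  · exact absurd (heq.2 h2) h2.not_gt
  · exact absurd (heq.1 h2) h2.not_gt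

/-- A bipartite graph has a function of values `±1` that changes sign along every edge;
multiplication by it intertwines `P` and `-P`. -/
theorem exists_sign_of_isBipartite {V : Type uV} [Fintype V] {w : Matrix V V ℝ}
    (hw : w.IsIrreducible) (hb : IsBipartite w) : ∃ σ : V → ℝ, (∀ a, σ a * σ a = 1) ∧ ∀ x : V → ℝ,
      (transition w *ᵥ fun a => σ a * x a) = fun a => -(σ a * (transition w *ᵥ x) a) := by
  obtain ⟨colour, hcol⟩ := hb
  refine ⟨fun a => if colour a then 1 else -1, fun a => by dsimp only; split_ifs <;> norm_num,
    fun x => ?_⟩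
  ext a
  simp only [mulVec, dotProduct, Finset.mul_sum, ← Finset.sum_neg_distrib]
  refine Finset.sum_congr rfl fun b _ => ?_
  rcases (hw.nonneg a b).eq_or_lt with h | h
  · simp [transition_apply, ← h]
  · have := hcol a b h
    cases ha : colour a <;> cases hb : colour b <;> simp_all

theorem exists_walkEigenvalue_eq_neg_one [Nonempty V] (hw : w.IsIrreducible) (hs : w.IsSymm)
    (hb : IsBipartite w) : ∃ i, walkEigenvalue hs i = -1 := by
  obtain ⟨σ, hσ, hσP⟩ := exists_sign_of_isBipartite hw hb
  refine exists_walkEigenvalue_eq hw hs (y := σ) (fun h => ?_) ?_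
  · obtain ⟨a⟩ := ‹Nonempty V›
    have := hσ a
    simp [h] at this
  · have := hσP 1
    rw [one_vecMul_of_mem_rowStochastic (transition_mem_rowStochastic hw)] at this
    simp only [Pi.one_apply, mul_one] at this
    rw [neg_one_smul]
    exact this

theorem eq_of_walkEigenvalue_eq_neg_one (hw : w.IsIrreducible) (hs : w.IsSymm)
    (hb : IsBipartite w) {i j : V} (hi : walkEigenvalue hs i = -1)
    (hj : walkEigenvalue hs j = -1) : i = j := by
  obtain ⟨σ, hσ, hσP⟩ := exists_sign_of_isBipartite hw hb
  have key : ∀ k, walkEigenvalue hs k = -1 →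
      ∃ a : ℝ, eigvec hs k = a • fun b => √(outDegree w b) * σ b := by
    intro k hk
    have h := transition_mulVec_walkEigvec hw hs k
    rw [hk, neg_one_smul] at h
    have h1 := hσP (walkEigvec hs k)
    rw [h] at h1
    simp only [Pi.neg_apply, mul_neg, neg_neg] at h1
    refine ⟨σ k * walkEigvec hs k k, ?_⟩
    have hc := fun b => eq_of_le_mulVec (transition_mem_rowStochastic hw)
      (transition_isIrreducible hw) h1.ge b k
    rw [eigvec_eq hw]
    ext b
    rw [Pi.smul_apply, smul_eq_mul, ← hc b]
    linear_combination (-(√(outDegree w b) * walkEigvec hs k b)) * hσ b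
  obtain ⟨a, ha⟩ := key i hi
  obtain ⟨b, hb⟩ := key j hj
  exact eq_of_eigvec_eq_smul hs ha hb

/-- On an undirected graph the stationary distribution is proportional to the degree, so that it is
the term of the spectral expansion for the eigenvalue `1`. -/
theorem stationary_eq (hw : w.IsIrreducible) (hs : w.IsSymm) {p : V → ℝ}
    (hp : IsStationary (transition w) p) {i : V} (hi : walkEigenvalue hs i = 1) (s v : V) :
    p v = (√(outDegree w s))⁻¹ * √(outDegree w v) * (eigvec hs i s * eigvec hs i v) := by
  obtain ⟨⟨-, hp1⟩, hpP⟩ := hp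
  -- by symmetry of `w` the density of `p` with respect to the degree is harmonic
  have hharm : transition w *ᵥ (fun a => p a / outDegree w a) = fun a => p a / outDegree w a := by
    ext a
    have h := congrFun hpP a
    rw [eq_div_iff (outDegree_pos hw a).ne']
    refine Eq.trans ?_ h
    simp only [mulVec, vecMul, dotProduct, Finset.sum_mul, transition_apply]
    refine Finset.sum_congr rfl fun b _ => ?_
    rw [hs.apply a b]
    have := (outDegree_pos hw a).ne'
    field_simp
  have hconst := fun b => eq_of_le_mulVec (transition_mem_rowStochastic hw)
    (transition_isIrreducible hw) hharm.ge b v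
  obtain ⟨a, ha⟩ := eigvec_eq_of_walkEigenvalue_eq_one hw hs hi
  have hsq : ∀ b, √(outDegree w b) * √(outDegree w b) = outDegree w b := fun b =>
    Real.mul_self_sqrt (outDegree_pos hw b).le
  have hnorm : a * a * ∑ b, outDegree w b = 1 := by
    have := eigvec_dotProduct_eigvec hs i i
    rw [if_pos rfl, ha, smul_dotProduct, dotProduct_smul] at this
    simp only [dotProduct, hsq, smul_eq_mul] at this
    rw [mul_assoc, this]
  have hpd : ∀ b, p b = p v / outDegree w v * outDegree w b := fun b => by
    rw [← hconst b, div_mul_cancel₀ _ (outDegree_pos hw b).ne']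
  have hsum : p v / outDegree w v * ∑ b, outDegree w b = 1 := by
    rw [Finset.mul_sum, ← hp1]
    exact Finset.sum_congr rfl fun b _ => (hpd b).symm
  have haa : a * a = p v / outDegree w v :=
    mul_right_cancel₀ (right_ne_zero_of_mul_eq_one hsum) (hnorm.trans hsum.symm)
  rw [ha]
  simp only [Pi.smul_apply, smul_eq_mul]
  calc p v = a * a * outDegree w v := by rw [haa]; exact hpd v
    _ = a * a * (√(outDegree w v) * √(outDegree w v)) := by rw [hsq]
    _ = _ := by
      have := (sqrt_outDegree_pos hw s).ne'
      field_simp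

/-- Accumulated over `n` steps, the deviation from stationarity is controlled by the geometric sums
of the eigenvalues other than the trivial one. -/
theorem abs_sum_transition_pow_sub_le (hw : w.IsIrreducible) (hs : w.IsSymm) {p : V → ℝ}
    (hp : IsStationary (transition w) p) {i₀ : V} (hi₀ : walkEigenvalue hs i₀ = 1) {n : ℕ} {Γ : ℝ}
    (hΓ0 : 0 ≤ Γ)
    (hΓ : ∀ i, i ≠ i₀ → |∑ j ∈ Finset.range n, walkEigenvalue hs i ^ j| ≤ Γ) (s v : V) :
    |∑ j ∈ Finset.range n, ((transition w ^ j) s v - p v)| ≤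
      Γ * ((√(outDegree w s))⁻¹ * √(outDegree w v)) := by
  have hterm : ∀ j, (transition w ^ j) s v - p v = (√(outDegree w s))⁻¹ * √(outDegree w v) *
      ∑ i ∈ Finset.univ.erase i₀, walkEigenvalue hs i ^ j * (eigvec hs i s * eigvec hs i v) := by
    intro j
    rw [transition_pow_apply_eq_sum hw hs, stationary_eq hw hs hp hi₀ s v,
      ← Finset.add_sum_erase _ _ (Finset.mem_univ i₀), hi₀, one_pow]
    ring
  have hcs : ∑ i, |eigvec hs i s * eigvec hs i v| ≤ 1 := by
    have h1 : ∑ i, (eigvec hs i s * eigvec hs i s + eigvec hs i v * eigvec hs i v) / 2 = 1 := by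
      rw [← Finset.sum_div, Finset.sum_add_distrib, sum_eigvec_mul_eigvec, sum_eigvec_mul_eigvec]
      norm_num
    rw [← h1]
    refine Finset.sum_le_sum fun i _ => ?_
    rw [abs_mul, ← abs_mul_abs_self (eigvec hs i s), ← abs_mul_abs_self (eigvec hs i v)]
    nlinarith [sq_nonneg (|eigvec hs i s| - |eigvec hs i v|)]
  simp only [hterm]
  rw [← Finset.mul_sum, Finset.sum_comm, abs_mul, abs_of_nonneg (by positivity), mul_comm Γ]
  refine mul_le_mul_of_nonneg_left ?_ (by positivity)
  calc |∑ i ∈ Finset.univ.erase i₀, ∑ j ∈ Finset.range n,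
        walkEigenvalue hs i ^ j * (eigvec hs i s * eigvec hs i v)|
      ≤ ∑ i ∈ Finset.univ.erase i₀, Γ * |eigvec hs i s * eigvec hs i v| := by
        refine (Finset.abs_sum_le_sum_abs _ _).trans (Finset.sum_le_sum fun i hi => ?_)
        rw [← Finset.sum_mul, abs_mul]
        exact mul_le_mul_of_nonneg_right (hΓ i (Finset.ne_of_mem_erase hi)) (abs_nonneg _)
    _ ≤ ∑ i, Γ * |eigvec hs i s * eigvec hs i v| :=
        Finset.sum_le_sum_of_subset_of_nonneg (Finset.erase_subset _ _) fun i _ _ => by positivity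
    _ ≤ Γ := by
        rw [← Finset.mul_sum]
        exact mul_le_of_le_one_right hΓ0 hcs

/-! ### The ordered eigenvalues -/

/-- The eigenvalues of the transition matrix in increasing order, that is, in the decreasing order
of the corresponding eigenvalues of the normalised Laplacian. -/
def walkEigenvalue₀ (hs : w.IsSymm) (k : Fin (Fintype.card V)) : ℝ :=
  1 - (normLaplacian_isHermitian hs).eigenvalues₀ k

theorem walkEigenvalue₀_monotone (hs : w.IsSymm) : Monotone (walkEigenvalue₀ hs) := fun _ _ h =>
  sub_le_sub_left ((normLaplacian_isHermitian hs).eigenvalues₀_antitone h) 1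

theorem exists_equiv_walkEigenvalue (hs : w.IsSymm) :
    ∃ e : V ≃ Fin (Fintype.card V), ∀ i, walkEigenvalue hs i = walkEigenvalue₀ hs (e i) :=
  ⟨(Fintype.equivOfCardEq (Fintype.card_fin _)).symm, fun _ => rfl⟩

theorem one_sub_lapEigenvalue (hs : w.IsSymm) {k : ℕ} (h1 : 1 ≤ k) (h2 : k ≤ Fintype.card V) :
    1 - lapEigenvalue hs k = walkEigenvalue₀ hs ⟨Fintype.card V - k, by omega⟩ := by
  rw [lapEigenvalue, dif_pos ⟨h1, h2⟩, walkEigenvalue₀]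

theorem abs_geom_sum_le {θ φ : ℝ} (h : |θ| ≤ φ) (hφ : φ < 1) (n : ℕ) :
    |∑ j ∈ Finset.range n, θ ^ j| ≤ (1 - φ ^ n) / (1 - φ) := by
  rw [← neg_div_neg_eq, neg_sub, neg_sub, ← geom_sum_eq hφ.ne]
  refine (Finset.abs_sum_le_sum_abs _ _).trans (Finset.sum_le_sum fun j _ => ?_)
  rw [abs_pow]
  exact pow_le_pow_left₀ (abs_nonneg _) h j

theorem abs_lt_one_of_ne {θ : ℝ} (h : |θ| ≤ 1) (h1 : θ ≠ 1) (h2 : θ ≠ -1) : |θ| < 1 := by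
  refine h.lt_of_ne fun h3 => ?_
  rcases eq_or_eq_neg_of_abs_eq h3 with h4 | h4
  exacts [h1 h4, h2 h4]

theorem abs_walkEigenvalue₀_le_one (hw : w.IsIrreducible) (hs : w.IsSymm)
    (k : Fin (Fintype.card V)) : |walkEigenvalue₀ hs k| ≤ 1 := by
  obtain ⟨e, he⟩ := exists_equiv_walkEigenvalue hs
  simpa [he] using abs_walkEigenvalue_le_one hw hs (e.symm k)

theorem walkEigenvalue₀_eq_one_iff (hw : w.IsIrreducible) (hs : w.IsSymm)
    (k : Fin (Fintype.card V)) : walkEigenvalue₀ hs k = 1 ↔ (k : ℕ) + 1 = Fintype.card V := by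
  obtain ⟨e, he⟩ := exists_equiv_walkEigenvalue hs
  have : Nonempty V := ⟨e.symm k⟩
  have hcard : 0 < Fintype.card V := Fintype.card_pos
  obtain ⟨i, hi⟩ := exists_walkEigenvalue_eq_one hw hs
  have hlast : walkEigenvalue₀ hs ⟨Fintype.card V - 1, by omega⟩ = 1 := by
    refine le_antisymm (abs_le.1 (abs_walkEigenvalue₀_le_one hw hs _)).2 ?_
    rw [← hi, he]
    exact walkEigenvalue₀_monotone hs (Fin.le_def.2 (by simp; omega))
  constructor
  · intro hk
    have h := eq_of_walkEigenvalue_eq_one hw hs (i := e.symm k)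
      (j := e.symm ⟨Fintype.card V - 1, by omega⟩) (by simpa [he] using hk)
      (by simpa [he] using hlast)
    rw [e.symm.injective.eq_iff, Fin.ext_iff] at h
    simp only at h
    omega
  · intro hk
    rw [← hlast]
    congr 1
    ext
    simp only
    omega

theorem walkEigenvalue₀_eq_neg_one_iff (hw : w.IsIrreducible) (hs : w.IsSymm)
    (hb : IsBipartite w) (k : Fin (Fintype.card V)) :
    walkEigenvalue₀ hs k = -1 ↔ (k : ℕ) = 0 := by
  obtain ⟨e, he⟩ := exists_equiv_walkEigenvalue hs
  have : Nonempty V := ⟨e.symm k⟩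
  have hcard : 0 < Fintype.card V := Fintype.card_pos
  obtain ⟨i, hi⟩ := exists_walkEigenvalue_eq_neg_one hw hs hb
  have hfirst : walkEigenvalue₀ hs ⟨0, by omega⟩ = -1 := by
    refine le_antisymm ?_ (abs_le.1 (abs_walkEigenvalue₀_le_one hw hs _)).1
    rw [← hi, he]
    exact walkEigenvalue₀_monotone hs (Fin.le_def.2 (by simp))
  constructor
  · intro hk
    have h := eq_of_walkEigenvalue_eq_neg_one hw hs hb (i := e.symm k)
      (j := e.symm ⟨0, by omega⟩) (by simpa [he] using hk) (by simpa [he] using hfirst)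
    rw [e.symm.injective.eq_iff, Fin.ext_iff] at h
    exact h
  · intro hk
    rw [← hfirst]
    congr 1
    ext
    exact hk

theorem walkEigenvalue₀_ne_neg_one (hw : w.IsIrreducible) (hs : w.IsSymm)
    (hb : ¬ IsBipartite w) (k : Fin (Fintype.card V)) : walkEigenvalue₀ hs k ≠ -1 := fun hk => by
  obtain ⟨e, he⟩ := exists_equiv_walkEigenvalue hs
  exact hb (isBipartite_of_walkEigenvalue_eq_neg_one hw hs (i := e.symm k) (by simpa [he] using hk))

theorem muStar_nonneg (hs : w.IsSymm) : 0 ≤ muStar hs := le_max_of_le_left (abs_nonneg _)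

theorem nuStar_nonneg (hs : w.IsSymm) : 0 ≤ nuStar hs := le_max_of_le_left (abs_nonneg _)

theorem muStar_lt_one (hw : w.IsIrreducible) (hs : w.IsSymm) (hV : 2 ≤ Fintype.card V)
    (hb : ¬ IsBipartite w) : muStar hs < 1 := by
  rw [muStar, one_sub_lapEigenvalue hs one_le_two hV,
    one_sub_lapEigenvalue hs (by omega) le_rfl]
  refine max_lt ?_ ?_ <;>
  refine abs_lt_one_of_ne (abs_walkEigenvalue₀_le_one hw hs _) (fun h => ?_)
    (walkEigenvalue₀_ne_neg_one hw hs hb _) <;>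
  · rw [walkEigenvalue₀_eq_one_iff hw] at h
    simp only at h
    omega

theorem nuStar_lt_one (hw : w.IsIrreducible) (hs : w.IsSymm) (hV : 3 ≤ Fintype.card V)
    (hb : IsBipartite w) : nuStar hs < 1 := by
  rw [nuStar, one_sub_lapEigenvalue hs one_le_two (by omega),
    one_sub_lapEigenvalue hs (by omega) (by omega)]
  refine max_lt ?_ ?_ <;>
  refine abs_lt_one_of_ne (abs_walkEigenvalue₀_le_one hw hs _) (fun h => ?_) fun h => ?_
  all_goals
    first
      | rw [walkEigenvalue₀_eq_one_iff hw] at h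
      | rw [walkEigenvalue₀_eq_neg_one_iff hw hs hb] at h
    simp only at h
    omega

theorem abs_geom_sum_walkEigenvalue_le_muStar (hw : w.IsIrreducible) (hs : w.IsSymm)
    (hV : 2 ≤ Fintype.card V) (hb : ¬ IsBipartite w) {i : V}
    (hi : walkEigenvalue hs i ≠ 1) (n : ℕ) :
    |∑ j ∈ Finset.range n, walkEigenvalue hs i ^ j| ≤ (1 - muStar hs ^ n) / (1 - muStar hs) := by
  refine abs_geom_sum_le ?_ (muStar_lt_one hw hs hV hb) n
  obtain ⟨e, he⟩ := exists_equiv_walkEigenvalue hs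
  rw [he, Ne, walkEigenvalue₀_eq_one_iff hw] at hi
  rw [muStar, one_sub_lapEigenvalue hs one_le_two hV, one_sub_lapEigenvalue hs (by omega) le_rfl,
    max_comm, he]
  exact abs_le_max_abs_abs (walkEigenvalue₀_monotone hs (Fin.le_def.2 (by simp)))
    (walkEigenvalue₀_monotone hs (Fin.le_def.2 (by simp only; omega)))

/-- For an even number of terms the geometric sum of the eigenvalue `-1` vanishes, which is why
`λ_{|V|}` may be left out of `nuStar`. -/
theorem abs_geom_sum_walkEigenvalue_le_nuStar (hw : w.IsIrreducible) (hs : w.IsSymm)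
    (hV : 3 ≤ Fintype.card V) (hb : IsBipartite w) {i : V} (hi : walkEigenvalue hs i ≠ 1) {n : ℕ}
    (hn : Even n) :
    |∑ j ∈ Finset.range n, walkEigenvalue hs i ^ j| ≤ (1 - nuStar hs ^ n) / (1 - nuStar hs) := by
  have hlt := nuStar_lt_one hw hs hV hb
  by_cases hi' : walkEigenvalue hs i = -1
  · rw [hi', neg_one_geom_sum, if_pos hn, abs_zero]
    exact div_nonneg (sub_nonneg.2 (pow_le_one₀ (nuStar_nonneg hs) hlt.le)) (sub_nonneg.2 hlt.le)
  refine abs_geom_sum_le ?_ hlt n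
  obtain ⟨e, he⟩ := exists_equiv_walkEigenvalue hs
  rw [he, Ne, walkEigenvalue₀_eq_one_iff hw] at hi
  rw [he, walkEigenvalue₀_eq_neg_one_iff hw hs hb] at hi'
  rw [nuStar, one_sub_lapEigenvalue hs one_le_two (by omega),
    one_sub_lapEigenvalue hs (by omega) (by omega), max_comm, he]
  exact abs_le_max_abs_abs
    (walkEigenvalue₀_monotone hs (Fin.le_def.2 (by simp only; omega)))
    (walkEigenvalue₀_monotone hs (Fin.le_def.2 (by simp only; omega)))

end Spectral

/-! ### The bound for undirected graphs -/

section Undirected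

open Matrix

variable {V : Type uV} [Fintype V] [DecidableEq V] {w : Matrix V V ℝ}

theorem undirectedBound_isBigO (f : V → ℝ) {φ : ℝ} (h0 : 0 ≤ φ) (h1 : φ < 1) (T : ℕ) (v c : V) :
    undirectedBound w f φ T v c =O[Filter.atTop] fun L : ℕ => 1 / (L : ℝ) := by
  set K := (∑ s, f s * (√(outDegree w s))⁻¹) * windowAverage w T (fun i => √(outDegree w i)) v c
    with hK
  refine IsBigO.of_bound (2 * (1 / (1 - φ)) * |K|) ?_
  filter_upwards [Filter.eventually_gt_atTop (2 * T)] with L hL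
  have hL' : 2 * (T : ℝ) < L := by exact_mod_cast hL
  have hT : (0 : ℝ) ≤ T := Nat.cast_nonneg T
  have hLpos : (0 : ℝ) < L := by linarith
  have hφ : 0 < 1 - φ := sub_pos.2 h1
  have hpow : φ ^ (L - T) ≤ 1 := pow_le_one₀ h0 h1.le
  have e1 : |1 / ((L : ℝ) - T)| ≤ 2 * (1 / L) := by
    rw [abs_of_nonneg (one_div_nonneg.2 (by linarith)), mul_one_div,
      div_le_div_iff₀ (by linarith) hLpos]
    linarith
  have e2 : |(1 - φ ^ (L - T)) / (1 - φ)| ≤ 1 / (1 - φ) := by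
    rw [abs_of_nonneg (div_nonneg (by linarith) hφ.le)]
    gcongr
    linarith [pow_nonneg h0 (L - T)]
  have e3 : undirectedBound w f φ T v c L =
      1 / ((L : ℝ) - T) * ((1 - φ ^ (L - T)) / (1 - φ)) * K := by
    rw [undirectedBound, hK, mul_assoc]
  rw [e3, Real.norm_eq_abs, Real.norm_eq_abs, abs_mul, abs_mul, abs_of_pos (one_div_pos.2 hLpos)]
  calc |1 / ((L : ℝ) - T)| * |(1 - φ ^ (L - T)) / (1 - φ)| * |K|
      ≤ 2 * (1 / L) * (1 / (1 - φ)) * |K| := by gcongr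
    _ = _ := by ring

theorem concentratesWith_undirectedBound [MeasurableSpace V] [MeasurableSingletonClass V]
    (hw : w.IsIrreducible) (hs : w.IsSymm) {p : V → ℝ}
    (hp : IsStationary (transition w) p) {f : V → ℝ} (hf : f ∈ stdSimplex ℝ V) {L T : ℕ}
    (hTL : T < L) {φ : ℝ} (h0 : 0 ≤ φ) (h1 : φ < 1)
    (hφ : ∀ i, walkEigenvalue hs i ≠ 1 →
      |∑ j ∈ Finset.range (L - T), walkEigenvalue hs i ^ j| ≤ (1 - φ ^ (L - T)) / (1 - φ))
    (v c : V) : ConcentratesWith.{uΩ} w p f L T v c (undirectedBound w f φ T v c L) := by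
  have : Nonempty V := ⟨v⟩
  obtain ⟨i₀, hi₀⟩ := exists_walkEigenvalue_eq_one hw hs
  set Γ := (1 - φ ^ (L - T)) / (1 - φ) with hΓ
  have hΓ0 : 0 ≤ Γ :=
    div_nonneg (sub_nonneg.2 (pow_le_one₀ h0 h1.le)) (sub_nonneg.2 h1.le)
  refine concentratesWith_of_occupation_le hw hTL
    (B := (Γ * ∑ s, f s * (√(outDegree w s))⁻¹) • fun a => √(outDegree w a)) (fun a => ?_) ?_
  · have hdev := fun s => abs_sum_transition_pow_sub_le hw hs hp hi₀ hΓ0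
      (fun i hi => hφ i fun h => hi (eq_of_walkEigenvalue_eq_one hw hs h hi₀)) s a
    simp only [vecMul_sub_eq_sum hf]
    rw [Finset.sum_comm]
    simp only [← Finset.mul_sum, Pi.smul_apply, smul_eq_mul]
    rw [Finset.mul_sum, Finset.sum_mul]
    refine (Finset.abs_sum_le_sum_abs _ _).trans (Finset.sum_le_sum fun s _ => ?_)
    rw [abs_mul, abs_of_nonneg (hf.1 s)]
    refine (mul_le_mul_of_nonneg_left (hdev s) (hf.1 s)).trans_eq ?_
    ring
  · rw [windowAverage_smul, undirectedBound, ← hΓ]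
    refine le_of_eq ?_
    ring

end Undirected

end WalkCorpus

/-! ### Concentration of the pair frequencies -/

theorem theorem6 {V : Type uV} [Fintype V] [DecidableEq V] [MeasurableSpace V]
    [MeasurableSingletonClass V] (w : Matrix V V ℝ) (hw : w.IsIrreducible) (p : V → ℝ)
    (hp : WalkCorpus.IsStationary (WalkCorpus.transition w) p) :
    -- undirected, non-bipartite
    (∀ hs : w.IsSymm, 2 ≤ Fintype.card V → ¬ WalkCorpus.IsBipartite w →
      ∀ f ∈ stdSimplex ℝ V, ∀ T : ℕ, 1 ≤ T → ∀ v c : V,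
        (WalkCorpus.undirectedBound w f (WalkCorpus.muStar hs) T v c
          =O[Filter.atTop] fun L : ℕ => 1 / (L : ℝ)) ∧
        ∀ L : ℕ, T < L → WalkCorpus.ConcentratesWith.{uΩ} w p f L T v c
          (WalkCorpus.undirectedBound w f (WalkCorpus.muStar hs) T v c L)) ∧
    -- undirected, bipartite, even `L - T`
    (∀ hs : w.IsSymm, 3 ≤ Fintype.card V → WalkCorpus.IsBipartite w →
      ∀ f ∈ stdSimplex ℝ V, ∀ T : ℕ, 1 ≤ T → ∀ v c : V,
        (WalkCorpus.undirectedBound w f (WalkCorpus.nuStar hs) T v c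
          =O[Filter.atTop] fun L : ℕ => 1 / (L : ℝ)) ∧
        ∀ L : ℕ, T < L → Even (L - T) → WalkCorpus.ConcentratesWith.{uΩ} w p f L T v c
          (WalkCorpus.undirectedBound w f (WalkCorpus.nuStar hs) T v c L)) ∧
    -- directed, aperiodic
    (WalkCorpus.IsAperiodic w →
      (∃ C α : ℝ, WalkCorpus.IsMixingConstants w p C α) ∧
      ∀ C α : ℝ, WalkCorpus.IsMixingConstants w p C α →
        ∀ f ∈ stdSimplex ℝ V, ∀ T : ℕ, 1 ≤ T → ∀ v c : V, ∀ L : ℕ, T < L →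
          WalkCorpus.ConcentratesWith.{uΩ} w p f L T v c
            (WalkCorpus.aperiodicBound w C α T v c L)) ∧
    -- directed, of any period: `U = g / (L - T)` with a constant `g` of the graph alone
    (∃ g : ℝ, 0 < g ∧
      ∀ f ∈ stdSimplex ℝ V, ∀ T : ℕ, 1 ≤ T → ∀ v c : V, ∀ L : ℕ, T < L →
        WalkCorpus.ConcentratesWith.{uΩ} w p f L T v c (g / ((L : ℝ) - T))) := by
  open WalkCorpus in
  refine ⟨fun hs hV hb f hf T _ v c => ?_, fun hs hV hb f hf T _ v c => ?_, fun ha => ?_, ?_⟩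
  · have hlt := muStar_lt_one hw hs hV hb
    exact ⟨undirectedBound_isBigO f (muStar_nonneg hs) hlt T v c, fun L hL =>
      concentratesWith_undirectedBound hw hs hp hf hL (muStar_nonneg hs) hlt
        (fun i hi => abs_geom_sum_walkEigenvalue_le_muStar hw hs hV hb hi _) v c⟩
  · have hlt := nuStar_lt_one hw hs hV hb
    exact ⟨undirectedBound_isBigO f (nuStar_nonneg hs) hlt T v c, fun L hL hev =>
      concentratesWith_undirectedBound hw hs hp hf hL (nuStar_nonneg hs) hlt
        (fun i hi => abs_geom_sum_walkEigenvalue_le_nuStar hw hs hV hb hi hev) v c⟩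
  · refine ⟨exists_isMixingConstants hw ha hp, fun C α hC f hf T _ v c L hL => ?_⟩
    refine concentratesWith_of_occupation_le hw hL
      (B := (C * ((1 - α ^ (L - T)) / (1 - α))) • fun _ => 1) (fun a => ?_) ?_
    · simpa using occupation_le_of_isMixingConstants hw hp hC hf (L - T) a
    · rw [windowAverage_smul, aperiodicBound]
      refine le_of_eq ?_
      ring
  · obtain ⟨g, hg, hocc⟩ := exists_occupation_le (transition_mem_rowStochastic hw)
      (transition_isIrreducible hw) hp
    refine ⟨g, hg, fun f hf T _ v c L hL => ?_⟩
    have hpos : 0 < (L : ℝ) - T := sub_pos.2 (by exact_mod_cast hL)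
    refine concentratesWith_of_occupation_le hw hL (B := g • fun _ => 1) (fun a => ?_) ?_
    · simpa using hocc f hf (L - T) a
    · rw [windowAverage_smul, one_div_mul_eq_div]
      exact div_le_div_of_nonneg_right
        (mul_le_of_le_one_right hg.le (windowAverage_one_le_one hw T v c)) hpos.le
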